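/- Consider hash tables with $m$ buckets of size $b=1$, numbered cyclically $0,1,\dots,m-1$. The keys $1,\dots,n$ have hash addresses $h_1,\dots,h_n\in\{0,\dots,m-1\}$ and are inserted in this order by linear probing with the first-come-first-served (FCFS) rule: key $i$ is stored in the first bucket among $h_i,h_i+1,h_i+2,\dots$ (modulo $m$) that is not occupied by a previously inserted key, and it is never moved. The displacement of key $i$ is the number of occupied buckets that it probes before it is stored. A table is almost full if it consists of a single cluster, that is, if its last bucket $m-1$ is empty and all its other buckets are occupied (so $n=m-1$); it is full if $n=m$ and every bucket is occupied. Let $FC_{m,n,k}$ be the number of almost full tables with $m$ buckets and $n$ keys, one of which is marked, such that the displacement of the marked key is $k$. Let $FC^{0}_{m,n,k}$ be the number of full tables with $m$ buckets and $n$ keys, one of which is marked, such that the last inserted key is stored in the last bucket and the displacement of the marked key is $k$. Let $$FC(z,w,q)=\sum_{m,n,k\ge0}FC_{m,n,k}\,w^m\frac{z^n}{n!}q^k,\qquad FC_0(z,w,q)=\sum_{m,n,k\ge0}FC^{0}_{m,n,k}\,w^m\frac{z^n}{n!}q^k,$$ and let $T(x)=\sum_{n\ge1}\frac{n^{n-1}}{n!}x^n$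 be the tree function. Theorem. As formal power series in $z,w,q$ (with the quotients taken in the field of fractions of $\mathbb{Q}[[z,w,q]]$), $$FC(z,w,q)=\frac{\bigl((1-T(zwq))^2-(1-T(zw))^2\bigr)\,T(zw)}{2z(1-q)(1-T(zw))}$$ and $$FC_0(z,w,q)=\frac{(1-T(zwq))^2-(1-T(zw))^2}{2(1-q)(1-T(zw))}.$$ -/

import Mathlib

open scoped Nat

noncomputable section

namespace LinearProbing

/-! A hash table with `m` buckets of size one, numbered cyclically `0, …, m - 1`, and `n` labelled
keys is given by the hash addresses `h : Fin n → Fin m`; the keys are inserted one at a time in the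
order of their labels. -/

/-- The bucket probed by a key with hash address `x` after `d` unsuccessful probes:
`x + d` modulo `m`. -/
def probe {m : ℕ} (x : Fin m) (d : ℕ) : Fin m :=
  ⟨((x : ℕ) + d) % m, Nat.mod_lt _ x.pos⟩

/-- The number of unsuccessful probes of a key with hash address `x` that is inserted by linear
probing when exactly the buckets in `S` are occupied. -/
def insertionCost {m : ℕ} (S : Finset (Fin m)) (x : Fin m) : ℕ :=
  sInf {d : ℕ | probe x d ∉ S}

/-- The set of occupied buckets after the first `t` keys have been inserted. -/
def occupied {m n : ℕ} (h : Fin n → Fin m) : ℕ → Finset (Fin m)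
  | 0 => ∅
  | t + 1 =>
    if ht : t < n then
      insert (probe (h ⟨t, ht⟩) (insertionCost (occupied h t) (h ⟨t, ht⟩))) (occupied h t)
    else occupied h t

/-- The displacement of key `i` under the first-come-first-served rule: the keys inserted later do
not move it, so this is its cost of insertion. -/
def displacement {m n : ℕ} (h : Fin n → Fin m) (i : Fin n) : ℕ :=
  insertionCost (occupied h i) (h i)

/-- The bucket in which key `i` is stored. -/
def location {m n : ℕ} (h : Fin n → Fin m) (i : Fin n) : Fin m :=
  probe (h i) (displacement h i)

/-- The table consists of a single cluster: the last bucket is empty, all others are full. -/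
def IsAlmostFull {m n : ℕ} (h : Fin n → Fin m) : Prop :=
  0 < m ∧ ∀ x : Fin m, x ∈ occupied h n ↔ (x : ℕ) + 1 ≠ m

/-- The table has as many keys as buckets and every bucket is full. -/
def IsFull {m n : ℕ} (h : Fin n → Fin m) : Prop :=
  n = m ∧ ∀ x : Fin m, x ∈ occupied h n

/-- The last inserted key is stored in the last bucket. -/
def LastKeyInLastBucket {m n : ℕ} (h : Fin n → Fin m) : Prop :=
  ∃ i : Fin n, (i : ℕ) + 1 = n ∧ (location h i : ℕ) + 1 = m

/-- The number of almost full tables with `m` buckets and `n` keys, one of them marked, in which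
the marked key has displacement `k`. -/
def countFC (m n k : ℕ) : ℕ :=
  {p : (Fin n → Fin m) × Fin n | IsAlmostFull p.1 ∧ displacement p.1 p.2 = k}.ncard

/-- The number of full tables with `m` buckets and `n` keys, one of them marked, in which the last
key is stored in the last bucket and the marked key has displacement `k`. -/
def countFC₀ (m n k : ℕ) : ℕ :=
  {p : (Fin n → Fin m) × Fin n |
    IsFull p.1 ∧ LastKeyInLastBucket p.1 ∧ displacement p.1 p.2 = k}.ncard

/-- Formal power series in `z`, `w`, `q` (the variables `0`, `1`, `2`) with rational
coefficients. -/
abbrev GF : Type := MvPowerSeries (Fin 3) ℚ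

/-- The variable `z`. -/
abbrev z : GF := MvPowerSeries.X 0

/-- The variable `w`. -/
abbrev w : GF := MvPowerSeries.X 1

/-- The variable `q`. -/
abbrev q : GF := MvPowerSeries.X 2

/-- `∑ countFC m n k * w ^ m * (z ^ n / n!) * q ^ k`. -/
def FC : GF := fun e => (countFC (e 1) (e 0) (e 2) : ℚ) / ((e 0)! : ℚ)

/-- `∑ countFC₀ m n k * w ^ m * (z ^ n / n!) * q ^ k`. -/
def FC₀ : GF := fun e => (countFC₀ (e 1) (e 0) (e 2) : ℚ) / ((e 0)! : ℚ)

/-- The tree function `∑_{n ≥ 1} n ^ (n - 1) / n! * X ^ n`. -/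
def treeFunction : PowerSeries ℚ :=
  PowerSeries.mk fun n => if n = 0 then 0 else (n : ℚ) ^ (n - 1) / (n ! : ℚ)

/-- The series `T(a)`, for a series `a` without constant term. -/
def T (a : GF) : GF := PowerSeries.subst a treeFunction

/-- The inclusion of the power series in their field of fractions, in which quotients are taken. -/
abbrev ι : GF →+* FractionRing GF := algebraMap GF (FractionRing GF)

end LinearProbing

end

open LinearProbing

noncomputable section

namespace LinearProbing

/-! Rotating all addresses rotates the table and preserves every displacement, so exactly one of the
`m` rotations of a table with `m - 1` keys is almost full. Counting almost full tables with a marked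
key thus reduces to counting arbitrary tables in which one further insertion costs `k`. Comparing
insertions at two neighbouring buckets gives a recursion in `k` (`costCount_eq_add`), whose
increment counts tables with an empty last bucket and an initial cluster of length exactly `k`. Such
a table splits at bucket `k` into two independent tables with empty last bucket
(`card_initial_cluster`), each counted by rotation (`succ_mul_lastEmptyCount`). The splitting works
because emptiness of a bucket depends only on the addresses, not on the order of insertion
(`notMem_lineOccupied_iff`).

Summing over the marked key telescopes (`sum_telescope`) and leaves a convolution of `n^(n-2)/n!`,
restricted to `n > k`, with `n^n/n!`. Let `U` and `B` be the generating functions of these two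
sequences and `A = (U(zw) - U(zwq))/(1 - q)`. Then `z FC = A (B(zw) - 1)`. Also `FC₀ = A B(zw)`,
because a full table of the required kind is an almost full one with an arbitrary last address
(`countFC₀_eq`). Finally `B = 1/(1 - T)` by Abel's identity, and `2U = 2T - T² = 1 - (1 - T)²`. -/

/-! ### Linear probing on a half-infinite table -/

/-- The first bucket at or after `a` that is not in `S`. -/
def firstHole (S : Finset ℕ) (a : ℕ) : ℕ := sInf {x | a ≤ x ∧ x ∉ S}

lemma firstHole_spec (S : Finset ℕ) (a : ℕ) : a ≤ firstHole S a ∧ firstHole S a ∉ S := by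
  have : ({x | a ≤ x ∧ x ∉ S} : Set ℕ).Nonempty := by
    obtain ⟨x, hx, hxS⟩ := (Set.Ici_infinite a).exists_notMem_finset S
    exact ⟨x, hx, hxS⟩
  exact Nat.sInf_mem this

lemma mem_of_lt_firstHole {S : Finset ℕ} {a x : ℕ} (hx : a ≤ x) (hlt : x < firstHole S a) :
    x ∈ S := by
  by_contra h
  exact Nat.notMem_of_lt_sInf hlt ⟨hx, h⟩

lemma firstHole_le {S : Finset ℕ} {a x : ℕ} (hx : a ≤ x) (hxS : x ∉ S) : firstHole S a ≤ x :=
  Nat.sInf_le ⟨hx, hxS⟩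

/-- The occupied buckets after `t` insertions into a half-infinite table. -/
def lineOccupied {n : ℕ} (h : Fin n → ℕ) : ℕ → Finset ℕ
  | 0 => ∅
  | t + 1 =>
    if ht : t < n then insert (firstHole (lineOccupied h t) (h ⟨t, ht⟩)) (lineOccupied h t)
    else lineOccupied h t

/-- The number of keys with address in `[y, x]`. -/
def load {ι : Type*} [Fintype ι] (h : ι → ℕ) (y x : ℕ) : ℕ :=
  (Finset.univ.filter fun i => y ≤ h i ∧ h i ≤ x).card

/-- The condition on the addresses under which bucket `x` of a half-infinite table stays empty. -/
def StaysEmpty {ι : Type*} [Fintype ι] (h : ι → ℕ) (x : ℕ) : Prop :=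
  ∀ y ≤ x, load h y x ≤ x - y

lemma filter_val_lt_succ {n t : ℕ} (ht : t < n) (p : Fin n → Prop) [DecidablePred p] :
    (Finset.univ.filter fun i : Fin n => (i : ℕ) < t + 1 ∧ p i).card =
      (Finset.univ.filter fun i : Fin n => (i : ℕ) < t ∧ p i).card +
        if p ⟨t, ht⟩ then 1 else 0 := by
  classical
  split_ifs with hp
  · rw [← Finset.card_insert_of_notMem (a := (⟨t, ht⟩ : Fin n)) (by simp)]
    congr 1
    ext i
    simp only [Finset.mem_filter, Finset.mem_univ, true_and, Finset.mem_insert, Fin.ext_iff]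
    constructor
    · rintro ⟨h1, h2⟩
      by_cases h3 : (i : ℕ) = t
      · exact Or.inl h3
      · exact Or.inr ⟨by omega, h2⟩
    · rintro (h1 | h1)
      · have : i = ⟨t, ht⟩ := Fin.ext h1
        subst this
        exact ⟨by simp, hp⟩
      · exact ⟨by omega, h1.2⟩
  · rw [add_zero]
    congr 1
    ext i
    simp only [Finset.mem_filter, Finset.mem_univ, true_and]
    constructor
    · rintro ⟨h1, h2⟩
      refine ⟨?_, h2⟩
      have : (i : ℕ) ≠ t := by
        rintro h3
        have : i = ⟨t, ht⟩ := Fin.ext h3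
        subst this
        exact hp h2
      omega
    · rintro ⟨h1, h2⟩
      exact ⟨by omega, h2⟩

lemma card_filter_lineOccupied_succ {n t : ℕ} (h : Fin n → ℕ) (ht : t < n) (p : ℕ → Prop)
    [DecidablePred p] :
    ((lineOccupied h (t + 1)).filter p).card = ((lineOccupied h t).filter p).card +
      if p (firstHole (lineOccupied h t) (h ⟨t, ht⟩)) then 1 else 0 := by
  rw [lineOccupied, dif_pos ht, Finset.filter_insert]
  split_ifs with hp
  · rw [Finset.card_insert_of_notMem]
    simp [(firstHole_spec _ _).2]
  · simp

/-- No key has crossed bucket `y - 1` while it is empty, so every key stored in `[y, x]` has its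
address there. The hypothesis is vacuous for `y = 0`. -/
lemma card_lineOccupied_le_load_aux {n : ℕ} (h : Fin n → ℕ) (y x : ℕ) :
    ∀ t ≤ n, (∀ v, v + 1 = y → v ∉ lineOccupied h t) →
      ((lineOccupied h t).filter fun v => y ≤ v ∧ v ≤ x).card ≤
        (Finset.univ.filter fun i : Fin n => (i : ℕ) < t ∧ y ≤ h i ∧ h i ≤ x).card := by
  intro t
  induction t with
  | zero => simp [lineOccupied]
  | succ t ih =>
    intro ht hy
    have ht' : t < n := ht
    have hsub : lineOccupied h t ⊆ lineOccupied h (t + 1) := by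
      rw [lineOccupied, dif_pos ht']; exact Finset.subset_insert _ _
    rw [card_filter_lineOccupied_succ h ht', filter_val_lt_succ ht']
    have := ih ht'.le fun v hv hv' => hy v hv (hsub hv')
    set b := firstHole (lineOccupied h t) (h ⟨t, ht'⟩) with hb
    have hspec := firstHole_spec (lineOccupied h t) (h ⟨t, ht'⟩)
    rw [← hb] at hspec
    by_cases h1 : y ≤ b ∧ b ≤ x
    · have h2 : y ≤ h ⟨t, ht'⟩ := by
        by_contra hlt
        obtain ⟨v, rfl⟩ : ∃ v, y = v + 1 := ⟨y - 1, by omega⟩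
        exact hy v rfl (hsub (mem_of_lt_firstHole (a := h ⟨t, ht'⟩) (by omega)
          (by rw [← hb]; omega)))
      rw [if_pos h1, if_pos ⟨h2, hspec.1.trans h1.2⟩]
      omega
    · rw [if_neg h1]
      omega

/-- While bucket `x` is empty, a key with address in `[y, x]` cannot pass it. -/
lemma load_le_card_lineOccupied_aux {n : ℕ} (h : Fin n → ℕ) (y x : ℕ) :
    ∀ t ≤ n, x ∉ lineOccupied h t →
      (Finset.univ.filter fun i : Fin n => (i : ℕ) < t ∧ y ≤ h i ∧ h i ≤ x).card ≤
        ((lineOccupied h t).filter fun v => y ≤ v ∧ v ≤ x).card := by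
  intro t
  induction t with
  | zero => simp
  | succ t ih =>
    intro ht hx
    have ht' : t < n := ht
    have hsub : lineOccupied h t ⊆ lineOccupied h (t + 1) := by
      rw [lineOccupied, dif_pos ht']; exact Finset.subset_insert _ _
    rw [card_filter_lineOccupied_succ h ht', filter_val_lt_succ ht']
    have := ih ht'.le fun hv' => hx (hsub hv')
    set b := firstHole (lineOccupied h t) (h ⟨t, ht'⟩) with hb
    have hspec := firstHole_spec (lineOccupied h t) (h ⟨t, ht'⟩)
    rw [← hb] at hspec
    by_cases h1 : y ≤ h ⟨t, ht'⟩ ∧ h ⟨t, ht'⟩ ≤ x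
    · have h2 : b ≤ x := firstHole_le h1.2 fun hv' => hx (hsub hv')
      rw [if_pos h1, if_pos ⟨h1.1.trans hspec.1, h2⟩]
      omega
    · rw [if_neg h1]
      omega

lemma card_lineOccupied_le_load {n : ℕ} (h : Fin n → ℕ) {y : ℕ} (x : ℕ)
    (hy : ∀ v, v + 1 = y → v ∉ lineOccupied h n) :
    ((lineOccupied h n).filter fun v => y ≤ v ∧ v ≤ x).card ≤ load h y x := by
  simpa [load] using card_lineOccupied_le_load_aux h y x n le_rfl hy

lemma load_le_card_lineOccupied {n : ℕ} (h : Fin n → ℕ) (y : ℕ) {x : ℕ}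
    (hx : x ∉ lineOccupied h n) :
    load h y x ≤ ((lineOccupied h n).filter fun v => y ≤ v ∧ v ≤ x).card := by
  simpa [load] using load_le_card_lineOccupied_aux h y x n le_rfl hx

lemma card_filter_Ico_le {S : Finset ℕ} {x : ℕ} (y : ℕ) (hx : x ∉ S) :
    (S.filter fun v => y ≤ v ∧ v ≤ x).card ≤ x - y := by
  rw [← Nat.card_Ico]
  apply Finset.card_le_card
  intro v hv
  simp only [Finset.mem_filter, Finset.mem_Ico] at hv ⊢
  have : v ≠ x := by rintro rfl; exact hx hv.1
  omega

/-- If `x` is empty, the keys with addresses in `[y, x]` fit into the `x - y` buckets before it. If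
`x` is occupied, the choice of `y` as left end of its run violates the bound: the run up to `x`
holds `x - y + 1` keys, all with addresses in `[y, x]`. -/
theorem notMem_lineOccupied_iff {n : ℕ} (h : Fin n → ℕ) (x : ℕ) :
    x ∉ lineOccupied h n ↔ StaysEmpty h x := by
  constructor
  · intro hx y _
    exact (load_le_card_lineOccupied h y hx).trans (card_filter_Ico_le y hx)
  · intro hE hx
    classical
    have hex : ∃ y, y ≤ x ∧ ∀ v, y ≤ v → v ≤ x → v ∈ lineOccupied h n :=
      ⟨x, le_rfl, fun v h1 h2 => by rwa [le_antisymm h2 h1]⟩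
    obtain ⟨hyx, hy⟩ := Nat.find_spec hex
    set y := Nat.find hex with hydef
    have hmin : ∀ v, v + 1 = y → v ∉ lineOccupied h n := by
      intro v hv hmem
      refine Nat.find_min hex (m := v) (by omega) ⟨by omega, fun u h1 h2 => ?_⟩
      rcases h1.eq_or_lt with rfl | h1
      · exact hmem
      · exact hy u (by omega) h2
    have h1 := card_lineOccupied_le_load h x hmin
    have h2 : (Finset.Icc y x).card ≤
        ((lineOccupied h n).filter fun v => y ≤ v ∧ v ≤ x).card := by
      apply Finset.card_le_card
      intro v hv
      simp only [Finset.mem_filter, Finset.mem_Icc] at hv ⊢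
      exact ⟨hy v hv.1 hv.2, hv⟩
    have h3 := hE y hyx
    rw [Nat.card_Icc] at h2
    omega

/-- The first `k` buckets are occupied and the next one is empty exactly if the latter stays empty
and exactly `k` addresses lie among the first `k + 1` buckets. -/
theorem initial_segment_iff {n : ℕ} (h : Fin n → ℕ) (k : ℕ) :
    (k ∉ lineOccupied h n ∧ ∀ v < k, v ∈ lineOccupied h n) ↔
      StaysEmpty h k ∧ load h 0 k = k := by
  rw [notMem_lineOccupied_iff]
  refine and_congr_right fun hE => ?_
  have hk := (notMem_lineOccupied_iff h k).2 hE
  have h1 := hE 0 (Nat.zero_le _)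
  have h2 := card_lineOccupied_le_load h (y := 0) k (by simp)
  have h3 := load_le_card_lineOccupied h 0 hk
  have h4 : ((lineOccupied h n).filter fun v => 0 ≤ v ∧ v ≤ k) ⊆ Finset.range k := by
    intro v hv
    simp only [Finset.mem_filter, Finset.mem_range] at hv ⊢
    exact lt_of_le_of_ne hv.2.2 (by rintro rfl; exact hk hv.1)
  constructor
  · intro hv
    have : Finset.range k ⊆ ((lineOccupied h n).filter fun v => 0 ≤ v ∧ v ≤ k) := by
      intro v hvk
      simp only [Finset.mem_filter, Finset.mem_range] at hvk ⊢
      exact ⟨hv v hvk, by omega, by omega⟩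
    have := Finset.card_le_card this
    rw [Finset.card_range] at this
    omega
  · intro hl v hv
    have := Finset.eq_of_subset_of_card_le h4 (by rw [Finset.card_range]; omega)
    have hm : v ∈ Finset.range k := by simpa using hv
    rw [← this] at hm
    exact (Finset.mem_filter.1 hm).1

/-! ### Cyclic tables -/

lemma probe_insertionCost_notMem {m : ℕ} {S : Finset (Fin m)} (hS : ∃ y, y ∉ S) (x : Fin m) :
    probe x (insertionCost S x) ∉ S := by
  obtain ⟨y, hy⟩ := hS
  have : ({d : ℕ | probe x d ∉ S} : Set ℕ).Nonempty := by
    -- Going around once more than necessary avoids a truncated `y - x`.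
    refine ⟨y + (m - x), ?_⟩
    have : probe x (y + (m - x)) = y := by
      apply Fin.ext
      have h1 := x.2
      have h2 : (x : ℕ) + (y + (m - x)) = y + m := by omega
      simp [probe, h2, Nat.mod_eq_of_lt y.2]
    simpa [this] using hy
  exact Nat.sInf_mem this

lemma probe_mem_of_lt_insertionCost {m : ℕ} {S : Finset (Fin m)} {x : Fin m} {d : ℕ}
    (hd : d < insertionCost S x) : probe x d ∈ S := by
  by_contra h
  exact Nat.notMem_of_lt_sInf hd h

lemma insertionCost_le {m : ℕ} {S : Finset (Fin m)} {x : Fin m} {d : ℕ}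
    (hd : probe x d ∉ S) : insertionCost S x ≤ d := Nat.sInf_le hd

lemma insertionCost_eq_iff {m : ℕ} {S : Finset (Fin m)} (hS : ∃ y, y ∉ S) (x : Fin m) (k : ℕ) :
    insertionCost S x = k ↔ probe x k ∉ S ∧ ∀ d < k, probe x d ∈ S := by
  constructor
  · rintro rfl
    exact ⟨probe_insertionCost_notMem hS x, fun d hd => probe_mem_of_lt_insertionCost hd⟩
  · rintro ⟨h1, h2⟩
    refine le_antisymm (insertionCost_le h1) ?_
    by_contra hlt
    exact probe_insertionCost_notMem hS x (h2 _ (by omega))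

lemma occupied_succ {m n t : ℕ} (h : Fin n → Fin m) (ht : t < n) :
    occupied h (t + 1) =
      insert (probe (h ⟨t, ht⟩) (insertionCost (occupied h t) (h ⟨t, ht⟩))) (occupied h t) := by
  rw [occupied, dif_pos ht]

lemma card_occupied_le {m n : ℕ} (h : Fin n → Fin m) (t : ℕ) : (occupied h t).card ≤ t := by
  induction t with
  | zero => simp [occupied]
  | succ t ih =>
    rw [occupied]
    split_ifs
    · exact (Finset.card_insert_le _ _).trans (by omega)
    · omega

lemma exists_notMem_of_card_lt {m : ℕ} {S : Finset (Fin m)} (hS : S.card < m) : ∃ y, y ∉ S := by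
  by_contra! hall
  have : S = Finset.univ := Finset.eq_univ_of_forall hall
  rw [this, Finset.card_univ, Fintype.card_fin] at hS
  omega

lemma exists_notMem_occupied {m n : ℕ} (h : Fin n → Fin m) {t : ℕ} (ht : t < m) :
    ∃ y, y ∉ occupied h t :=
  exists_notMem_of_card_lt ((card_occupied_le h t).trans_lt ht)

lemma card_occupied {m n : ℕ} (h : Fin n → Fin m) :
    ∀ t ≤ n, t ≤ m → (occupied h t).card = t := by
  intro t
  induction t with
  | zero => simp [occupied]
  | succ t ih =>
    intro h1 h2
    rw [occupied_succ h h1, Finset.card_insert_of_notMem, ih (by omega) (by omega)]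
    exact probe_insertionCost_notMem (exists_notMem_occupied h h2) _

lemma occupied_mono {m n : ℕ} (h : Fin n → Fin m) : Monotone (occupied h) := by
  refine monotone_nat_of_le_succ fun t => ?_
  rw [occupied]
  split_ifs
  · exact Finset.subset_insert _ _
  · exact le_rfl

/-- Insertions agree with those into a half-infinite table as long as bucket `M` stays empty in
either. -/
lemma mem_occupied_iff_aux {M n : ℕ} (h : Fin n → Fin (M + 1)) :
    ∀ t ≤ n, (Fin.last M ∉ occupied h t ∨ M ∉ lineOccupied (fun i => (h i : ℕ)) t) →
      ∀ x : Fin (M + 1), x ∈ occupied h t ↔ (x : ℕ) ∈ lineOccupied (fun i => (h i : ℕ)) t := by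
  intro t
  induction t with
  | zero => simp [occupied, lineOccupied]
  | succ t ih =>
    intro ht hor
    have ht' : t < n := ht
    set S := occupied h t
    set R := lineOccupied (fun i => (h i : ℕ)) t
    rw [occupied_succ h ht', lineOccupied, dif_pos ht'] at hor ⊢
    -- Occupancy only grows, so either alternative is inherited from the previous stage; the
    -- induction hypothesis then turns it into the other. Bucket `M` being free, the next key does
    -- not wrap around.
    have hor' : Fin.last M ∉ S ∨ M ∉ R := hor.imp
      (fun h1 h2 => h1 (Finset.mem_insert_of_mem h2))
      (fun h1 h2 => h1 (Finset.mem_insert_of_mem h2))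
    have key := ih ht'.le hor'
    have hS : Fin.last M ∉ S := by
      rcases hor' with h1 | h1
      · exact h1
      · rw [key]; exact h1
    have hR : M ∉ R := by rw [key] at hS; exact hS
    set a := h ⟨t, ht'⟩
    have haM : (a : ℕ) ≤ M := Nat.lt_succ_iff.1 a.2
    have hb := firstHole_spec R a
    have hbM : firstHole R a ≤ M := firstHole_le haM hR
    have hpv : ∀ d, (a : ℕ) + d ≤ M → ((probe a d : Fin (M + 1)) : ℕ) = a + d := fun d hd => by
      simp [probe, Nat.mod_eq_of_lt (Nat.lt_succ_of_le hd)]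
    have hcost : insertionCost S a = firstHole R a - a := by
      rw [insertionCost_eq_iff ⟨_, hS⟩]
      constructor
      · rw [key, hpv _ (by omega), Nat.add_sub_cancel' hb.1]
        exact hb.2
      · intro d hd
        rw [key, hpv _ (by omega)]
        exact mem_of_lt_firstHole (a := a) (by omega) (by omega)
    have hval : ((probe a (insertionCost S a) : Fin (M + 1)) : ℕ) = firstHole R a := by
      rw [hpv _ (by omega), hcost, Nat.add_sub_cancel' hb.1]
    intro x
    rw [Finset.mem_insert, Finset.mem_insert, key, Fin.ext_iff, hval]

lemma last_notMem_occupied_iff {M n : ℕ} (h : Fin n → Fin (M + 1)) :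
    Fin.last M ∉ occupied h n ↔ StaysEmpty (fun i => (h i : ℕ)) M := by
  rw [← notMem_lineOccupied_iff]
  constructor
  · intro h1
    rw [mem_occupied_iff_aux h n le_rfl (Or.inl h1)] at h1
    exact h1
  · intro h1
    rw [mem_occupied_iff_aux h n le_rfl (Or.inr h1)]
    exact h1

lemma mem_occupied_iff {M n : ℕ} {h : Fin n → Fin (M + 1)} (hl : Fin.last M ∉ occupied h n)
    (x : Fin (M + 1)) : x ∈ occupied h n ↔ (x : ℕ) ∈ lineOccupied (fun i => (h i : ℕ)) n :=
  mem_occupied_iff_aux h n le_rfl (Or.inl hl) x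

/-- A cluster of length `k` at the beginning of the table, in terms of the addresses. -/
theorem initial_cluster_iff {M n : ℕ} (h : Fin n → Fin (M + 1)) (k : Fin (M + 1)) :
    (Fin.last M ∉ occupied h n ∧ k ∉ occupied h n ∧ ∀ v < k, v ∈ occupied h n) ↔
      StaysEmpty (fun i => (h i : ℕ)) M ∧ StaysEmpty (fun i => (h i : ℕ)) k ∧
        load (fun i => (h i : ℕ)) 0 k = k := by
  rw [← last_notMem_occupied_iff]
  refine and_congr_right fun hl => ?_
  rw [← initial_segment_iff, mem_occupied_iff hl]
  refine and_congr_right fun _ => ?_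
  constructor
  · intro hv v hvk
    have := hv ⟨v, by omega⟩ (Fin.lt_def.2 hvk)
    rwa [mem_occupied_iff hl] at this
  · intro hv v hvk
    rw [mem_occupied_iff hl]
    exact hv v hvk

/-! ### Rotations -/

lemma probe_add {m : ℕ} (x c : Fin m) (d : ℕ) : probe (x + c) d = probe x d + c := by
  apply Fin.ext
  simp [probe, Fin.val_add, add_right_comm]

lemma insertionCost_add {m : ℕ} {S R : Finset (Fin m)} {c : Fin m}
    (hSR : ∀ x, x + c ∈ R ↔ x ∈ S) (x : Fin m) :
    insertionCost R (x + c) = insertionCost S x := by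
  simp [insertionCost, probe_add, hSR]

lemma mem_occupied_add {m n : ℕ} (h : Fin n → Fin m) (c : Fin m) (t : ℕ) :
    ∀ x : Fin m, x + c ∈ occupied (fun i => h i + c) t ↔ x ∈ occupied h t := by
  induction t with
  | zero => simp [occupied]
  | succ t ih =>
    intro x
    have : NeZero m := ⟨x.pos.ne'⟩
    rw [occupied, occupied]
    split_ifs with ht
    · rw [Finset.mem_insert, Finset.mem_insert, ih, insertionCost_add ih, probe_add,
        add_left_inj]
    · exact ih x

lemma displacement_add {m n : ℕ} (h : Fin n → Fin m) (c : Fin m) (i : Fin n) :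
    displacement (fun i => h i + c) i = displacement h i :=
  insertionCost_add (mem_occupied_add h c i) _

lemma card_filter_rotate {ι : Type*} [Fintype ι] [DecidableEq ι] {m : ℕ} [NeZero m] (c : Fin m)
    {P Q : (ι → Fin m) → Prop}
    [DecidablePred P] [DecidablePred Q] (hPQ : ∀ h, P h ↔ Q fun i => h i + c) :
    (Finset.univ.filter P).card = (Finset.univ.filter Q).card :=
  Finset.card_equiv ((Equiv.refl ι).arrowCongr (Equiv.addRight c)) fun h => by
    simp only [Finset.mem_filter, Finset.mem_univ, true_and]
    exact hPQ h

lemma card_notMem_occupied_eq {m n : ℕ} [NeZero m] (x y : Fin m) :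
    (Finset.univ.filter fun h : Fin n → Fin m => x ∉ occupied h n).card =
      (Finset.univ.filter fun h : Fin n → Fin m => y ∉ occupied h n).card :=
  card_filter_rotate (y - x) fun h => by
    rw [← mem_occupied_add h (y - x), add_sub_cancel]

open Classical in
/-- The number of tables on `M + 1` buckets, keys indexed by `ι`, whose last bucket is empty. -/
def lastEmptyCount (ι : Type*) [Fintype ι] (M : ℕ) : ℕ :=
  (Finset.univ.filter fun h : ι → Fin (M + 1) => StaysEmpty (fun i => (h i : ℕ)) M).card

lemma load_comp_equiv {ι κ : Type*} [Fintype ι] [Fintype κ] (e : κ ≃ ι) (h : ι → ℕ) (y x : ℕ) :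
    load (fun i => h (e i)) y x = load h y x :=
  Finset.card_equiv e fun i => by simp

/-- `StaysEmpty` sees only loads, so labels are irrelevant. This serves the parts of a split table,
whose keys are indexed by subtypes. -/
lemma lastEmptyCount_congr {ι κ : Type*} [Fintype ι] [Fintype κ] (e : ι ≃ κ) (M : ℕ) :
    lastEmptyCount ι M = lastEmptyCount κ M := by
  classical
  refine Finset.card_equiv (e.arrowCongr (Equiv.refl _)) fun h => ?_
  have : ∀ y x, load (fun i => (((e.arrowCongr (Equiv.refl (Fin (M + 1)))) h i : Fin _) : ℕ)) y x =
      load (fun i => (h i : ℕ)) y x := fun y x =>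
    load_comp_equiv e.symm (fun i => (h i : ℕ)) y x
  simp only [Finset.mem_filter, Finset.mem_univ, true_and]
  simp only [StaysEmpty, this]

lemma lastEmptyCount_fin (n M : ℕ) :
    lastEmptyCount (Fin n) M =
      (Finset.univ.filter fun h : Fin n → Fin (M + 1) => Fin.last M ∉ occupied h n).card := by
  rw [lastEmptyCount]
  congr 1
  ext h
  simp only [Finset.mem_filter, Finset.mem_univ, true_and, last_notMem_occupied_iff]

/-- Double counting of pairs of a table and an empty bucket: by rotation each bucket is empty
equally often, and each table has `M + 1 - n` empty buckets. -/
theorem succ_mul_lastEmptyCount {n M : ℕ} (hn : n ≤ M + 1) :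
    (M + 1) * lastEmptyCount (Fin n) M = (M + 1 - n) * (M + 1) ^ n := by
  classical
  have h1 := Finset.sum_card_bipartiteAbove_eq_sum_card_bipartiteBelow
    (s := (Finset.univ : Finset (Fin (M + 1)))) (t := (Finset.univ : Finset (Fin n → Fin (M + 1))))
    (fun x h => x ∉ occupied h n)
  have h2 : ∀ x ∈ (Finset.univ : Finset (Fin (M + 1))), (Finset.bipartiteAbove
      (fun x (h : Fin n → Fin (M + 1)) => x ∉ occupied h n) Finset.univ x).card =
        lastEmptyCount (Fin n) M := fun x _ => by
    rw [lastEmptyCount_fin, ← card_notMem_occupied_eq x]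
    rfl
  have h3 : ∀ h ∈ (Finset.univ : Finset (Fin n → Fin (M + 1))), (Finset.bipartiteBelow
      (fun x (h : Fin n → Fin (M + 1)) => x ∉ occupied h n) Finset.univ h).card = M + 1 - n :=
    fun h _ => by
      have h4 : Finset.bipartiteBelow (fun x (h : Fin n → Fin (M + 1)) => x ∉ occupied h n)
          Finset.univ h = (occupied h n)ᶜ := by
        ext x; simp [Finset.bipartiteBelow]
      rw [h4, Finset.card_compl, card_occupied h n le_rfl hn, Fintype.card_fin]
  rw [Finset.sum_congr rfl h2, Finset.sum_congr rfl h3] at h1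
  simpa [mul_comm] using h1

/-! ### Tables that begin with a cluster of given length -/

lemma load_eq_add {ι : Type*} [Fintype ι] (p : ι → Prop) [DecidablePred p] (h : ι → ℕ)
    (y x : ℕ) :
    load h y x = load (fun i : {i // p i} => h i) y x +
      load (fun i : {i // ¬ p i} => h i) y x := by
  simp only [load, Finset.card_filter]
  exact (Fintype.sum_subtype_add_sum_subtype p
    (fun i => if y ≤ h i ∧ h i ≤ x then 1 else 0)).symm

lemma load_eq_zero {ι : Type*} [Fintype ι] {h : ι → ℕ} {y x : ℕ}
    (hh : ∀ i, ¬ (y ≤ h i ∧ h i ≤ x)) : load h y x = 0 := by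
  simp [load, hh]

lemma load_congr {ι : Type*} [Fintype ι] {h g : ι → ℕ} {y x y' x' : ℕ}
    (hh : ∀ i, (y ≤ h i ∧ h i ≤ x) ↔ (y' ≤ g i ∧ g i ≤ x')) : load h y x = load g y' x' := by
  simp [load, hh]

/-- An interval that ends in the right block and starts in the left one has load at most `(k - y) +
L`, which is within the bound; all other intervals see only one block. -/
lemma staysEmpty_glue_iff {ι : Type*} [Fintype ι] (p : ι → Prop) [DecidablePred p] {k L : ℕ}
    {h : ι → ℕ} {f : {i // p i} → ℕ} {g : {i // ¬ p i} → ℕ}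
    (hf : ∀ i, f i ≤ k)
    (hhf : ∀ i : {i // p i}, h i = f i) (hhg : ∀ i : {i // ¬ p i}, h i = g i + (k + 1)) :
    (StaysEmpty h (k + 1 + L) ∧ StaysEmpty h k) ↔ (StaysEmpty f k ∧ StaysEmpty g L) := by
  classical
  have l1 : ∀ y, load h y k = load f y k := fun y => by
    rw [load_eq_add p, load_eq_zero (h := fun i : {i // ¬ p i} => h i) fun i => by
      rw [hhg]; omega]
    simp [hhf]
  have l2 : ∀ y, load h (y + (k + 1)) (k + 1 + L) = load g y L := fun y => by
    rw [load_eq_add p, load_eq_zero (h := fun i : {i // p i} => h i) fun i => by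
      have := hf i; rw [hhf]; omega, zero_add]
    exact load_congr fun i => by rw [hhg]; omega
  have l3 : ∀ y ≤ k, load h y (k + 1 + L) = load f y k + load g 0 L := fun y hy => by
    rw [load_eq_add p]
    congr 1
    · exact load_congr fun i => by have := hf i; rw [hhf]; omega
    · exact load_congr fun i => by rw [hhg]; omega
  constructor
  · rintro ⟨h1, h2⟩
    refine ⟨fun y hy => by rw [← l1]; exact h2 y hy, fun y hy => ?_⟩
    have := h1 (y + (k + 1)) (by omega)
    rw [l2] at this
    omega
  · rintro ⟨h1, h2⟩
    refine ⟨fun y hy => ?_, fun y hy => by rw [l1]; exact h1 y hy⟩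
    by_cases hyk : y ≤ k
    · rw [l3 y hyk]
      have := h1 y hyk
      have := h2 0 (Nat.zero_le _)
      omega
    · obtain ⟨v, rfl⟩ : ∃ v, y = v + (k + 1) := ⟨y - (k + 1), by omega⟩
      rw [l2]
      have := h2 v (by omega)
      omega

open Classical in
-- With the set of keys to the left of the cut fixed, gluing a table on `k + 1` buckets to one on `L
-- + 1` buckets, shifted by `k + 1`, is a bijection.
lemma card_cluster_fiber {ι : Type*} [Fintype ι] (p : ι → Prop) (k L : ℕ) :
    (Finset.univ.filter fun h : ι → Fin (k + 1 + L + 1) =>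
      (StaysEmpty (fun i => (h i : ℕ)) (k + 1 + L) ∧ StaysEmpty (fun i => (h i : ℕ)) k) ∧
        ∀ i, p i ↔ (h i : ℕ) ≤ k).card =
      lastEmptyCount {i // p i} k * lastEmptyCount {i // ¬ p i} L := by
  rw [lastEmptyCount, lastEmptyCount, ← Finset.card_product]
  symm
  let glue : ({i // p i} → Fin (k + 1)) × ({i // ¬ p i} → Fin (L + 1)) →
      ι → Fin (k + 1 + L + 1) := fun u i =>
    if hi : p i then ⟨u.1 ⟨i, hi⟩, by have := (u.1 ⟨i, hi⟩).2; omega⟩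
    else ⟨u.2 ⟨i, hi⟩ + (k + 1), by have := (u.2 ⟨i, hi⟩).2; omega⟩
  have g1 : ∀ u (i : {i // p i}), (glue u i : ℕ) = u.1 i := fun u i => by
    simp [glue, i.2]
  have g2 : ∀ u (i : {i // ¬ p i}), (glue u i : ℕ) = u.2 i + (k + 1) := fun u i => by
    simp [glue, i.2]
  have key : ∀ u, (StaysEmpty (fun i => (glue u i : ℕ)) (k + 1 + L) ∧
      StaysEmpty (fun i => (glue u i : ℕ)) k) ↔
      (StaysEmpty (fun i => (u.1 i : ℕ)) k ∧ StaysEmpty (fun i => (u.2 i : ℕ)) L) := fun u =>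
    staysEmpty_glue_iff p (fun i => Nat.lt_succ_iff.1 (u.1 i).2)
      (g1 u) (g2 u)
  refine Finset.card_bij (fun u _ => glue u) ?_ ?_ ?_
  · intro u hu
    simp only [Finset.mem_product, Finset.mem_filter, Finset.mem_univ, true_and] at hu ⊢
    refine ⟨(key u).2 hu, ?_⟩
    intro i
    by_cases hi : p i
    · have : (glue u i : ℕ) = u.1 ⟨i, hi⟩ := g1 u ⟨i, hi⟩
      have := (u.1 ⟨i, hi⟩).2
      simp only [hi, true_iff]
      omega
    · have : (glue u i : ℕ) = u.2 ⟨i, hi⟩ + (k + 1) := g2 u ⟨i, hi⟩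
      simp only [hi, false_iff]
      omega
  · intro u _ v _ huv
    apply Prod.ext
    · funext i
      apply Fin.ext
      rw [← g1, ← g1, huv]
    · funext i
      apply Fin.ext
      have h1 := g2 u i
      have h2 := g2 v i
      rw [huv] at h1
      omega
  · intro h hh
    simp only [Finset.mem_filter, Finset.mem_univ, true_and] at hh
    have hA : ∀ i, p i ↔ (h i : ℕ) ≤ k := hh.2
    let u : ({i // p i} → Fin (k + 1)) × ({i // ¬ p i} → Fin (L + 1)) :=
      (fun i => ⟨h i, Nat.lt_succ_of_le ((hA i).1 i.2)⟩,
        fun i => ⟨h i - (k + 1), by have := (h i).2; omega⟩)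
    have hu : glue u = h := by
      funext i
      apply Fin.ext
      by_cases hi : p i
      · exact g1 u ⟨i, hi⟩
      · refine (g2 u ⟨i, hi⟩).trans ?_
        rw [hA] at hi
        exact Nat.sub_add_cancel (Nat.lt_of_not_le hi)
    refine ⟨u, ?_, hu⟩
    simp only [Finset.mem_product, Finset.mem_filter, Finset.mem_univ, true_and]
    rw [← key, hu]
    exact hh.1

open Classical in
-- The load condition says that the set of keys with address at most `k` has `k` elements; the
-- binomial coefficient counts these sets.
theorem card_initial_cluster (n k L : ℕ) :
    (Finset.univ.filter fun h : Fin n → Fin (k + 1 + L + 1) =>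
      StaysEmpty (fun i => (h i : ℕ)) (k + 1 + L) ∧ StaysEmpty (fun i => (h i : ℕ)) k ∧
        load (fun i => (h i : ℕ)) 0 k = k).card =
      n.choose k * (lastEmptyCount (Fin k) k * lastEmptyCount (Fin (n - k)) L) := by
  rw [Finset.card_eq_sum_card_fiberwise (t := Finset.powersetCard k Finset.univ)
    (f := fun h : Fin n → Fin (k + 1 + L + 1) => Finset.univ.filter fun i => (h i : ℕ) ≤ k)]
  · have : ∀ A ∈ Finset.powersetCard k (Finset.univ : Finset (Fin n)),
        ((Finset.univ.filter fun h : Fin n → Fin (k + 1 + L + 1) =>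
          StaysEmpty (fun i => (h i : ℕ)) (k + 1 + L) ∧ StaysEmpty (fun i => (h i : ℕ)) k ∧
            load (fun i => (h i : ℕ)) 0 k = k).filter
              fun h => (Finset.univ.filter fun i => (h i : ℕ) ≤ k) = A).card =
          lastEmptyCount (Fin k) k * lastEmptyCount (Fin (n - k)) L := by
      intro A hA
      rw [Finset.mem_powersetCard] at hA
      have e1 : {i // i ∈ A} ≃ Fin k := A.equivFinOfCardEq hA.2
      have e2 : {i // i ∉ A} ≃ Fin (n - k) := Fintype.equivFinOfCardEq (by
        rw [Fintype.card_subtype_compl]; simp [hA.2])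
      refine Eq.trans ?_ ((card_cluster_fiber (· ∈ A) k L).trans (congrArg₂ (· * ·)
        (@lastEmptyCount_congr _ _ (_) (_) e1 k) (@lastEmptyCount_congr _ _ (_) (_) e2 L)))
      congr 1
      ext h
      simp only [Finset.mem_filter, Finset.mem_univ, true_and]
      constructor
      · rintro ⟨⟨h1, h2, _⟩, h3⟩
        exact ⟨⟨h1, h2⟩, fun i => by rw [← h3]; simp⟩
      · rintro ⟨⟨h1, h2⟩, h3⟩
        replace h3 : (Finset.univ.filter fun i => (h i : ℕ) ≤ k) = A := by
          ext i; simp [h3]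
        refine ⟨⟨h1, h2, ?_⟩, h3⟩
        refine Eq.trans ?_ hA.2
        rw [load, ← h3]
        simp
    rw [Finset.sum_congr rfl this, Finset.sum_const, Finset.card_powersetCard, Finset.card_univ,
      Fintype.card_fin, smul_eq_mul]
  · intro h hh
    rw [Finset.mem_coe, Finset.mem_filter] at hh
    rw [Finset.mem_coe, Finset.mem_powersetCard]
    have := hh.2.2.2
    rw [load] at this
    simpa using this

/-! ### The cost of one insertion -/

/-- The number of tables with `n` keys in which the insertion of a key with address `0` costs
`k`. -/
def costCount (n M k : ℕ) : ℕ :=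
  (Finset.univ.filter fun g : Fin n → Fin (M + 1) => insertionCost (occupied g n) 0 = k).card

/-- The number of tables with `n` keys in which the last bucket and bucket `k` are empty and the
buckets before the latter are occupied. -/
def clusterCount (n M k : ℕ) : ℕ :=
  n.choose k * (lastEmptyCount (Fin k) k * lastEmptyCount (Fin (n - k)) (M - 1 - k))

lemma card_insertionCost_eq (n M k : ℕ) (x : Fin (M + 1)) :
    (Finset.univ.filter fun g : Fin n → Fin (M + 1) => insertionCost (occupied g n) x = k).card =
      costCount n M k := by
  symm
  refine card_filter_rotate x fun h => ?_
  rw [← insertionCost_add (mem_occupied_add h x n) 0, zero_add]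

lemma insertionCost_zero_eq_iff {n M : ℕ} (g : Fin n → Fin (M + 1)) (hn : n < M + 1)
    (k : Fin (M + 1)) :
    insertionCost (occupied g n) 0 = k ↔ k ∉ occupied g n ∧ ∀ v < k, v ∈ occupied g n := by
  have hp : ∀ v : Fin (M + 1), probe 0 (v : ℕ) = v := fun v => by
    apply Fin.ext
    simp [probe, Nat.mod_eq_of_lt v.2]
  rw [insertionCost_eq_iff (exists_notMem_occupied g hn), hp]
  refine and_congr_right fun _ => ⟨fun h v hv => ?_, fun h d hd => ?_⟩
  · rw [← hp v]
    exact h v hv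
  · have hd' : d < M + 1 := hd.trans k.2
    have := hp ⟨d, hd'⟩
    simp only at this
    rw [this]
    exact h _ (Fin.lt_def.2 hd)

lemma insertionCost_zero_eq_succ_iff {M k : ℕ} {S : Finset (Fin (M + 1))} (hS : ∃ y, y ∉ S) :
    insertionCost S 0 = k + 1 ↔ 0 ∈ S ∧ insertionCost S (0 + 1) = k := by
  have h0 : probe (0 : Fin (M + 1)) 0 = 0 := by apply Fin.ext; simp [probe]
  have h1 : ∀ d, probe (0 : Fin (M + 1)) (d + 1) = probe (0 + 1) d := fun d => by
    apply Fin.ext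
    simp [probe, add_comm]
  rw [insertionCost_eq_iff hS, insertionCost_eq_iff hS, h1]
  constructor
  · rintro ⟨h2, h3⟩
    refine ⟨by rw [← h0]; exact h3 0 (by omega), h2, fun d hd => ?_⟩
    rw [← h1]
    exact h3 _ (by omega)
  · rintro ⟨h2, h3, h4⟩
    refine ⟨h3, fun d hd => ?_⟩
    rcases d with _ | d
    · rwa [h0]
    · rw [h1]
      exact h4 d (by omega)

/-- As `k < M`, bucket `k` is not the last one, and the table splits there. -/
lemma card_lastEmpty_insertionCost {n M k : ℕ} (hk : k < M) (hn : n < M + 1) :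
    (Finset.univ.filter fun g : Fin n → Fin (M + 1) =>
      Fin.last M ∉ occupied g n ∧ insertionCost (occupied g n) 0 = k).card =
        clusterCount n M k := by
  classical
  obtain ⟨L, rfl⟩ : ∃ L, M = k + 1 + L := ⟨M - (k + 1), by omega⟩
  have hL : k + 1 + L - 1 - k = L := by omega
  rw [clusterCount, hL, ← card_initial_cluster]
  congr 1
  ext g
  simp only [Finset.mem_filter, Finset.mem_univ, true_and]
  have h1 := insertionCost_zero_eq_iff g hn ⟨k, by omega⟩
  have h2 := initial_cluster_iff g ⟨k, by omega⟩
  simp only at h1 h2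
  rw [← h2, ← h1]

/-- Consider an insertion at bucket `1` of cost `k`. If bucket `0` is occupied, an insertion there
costs `k + 1`. If it is empty, rotating back by one moves it to the last place and the address to
`0`. -/
lemma costCount_eq_add {n M k : ℕ} (hk : k < M) (hn : n < M + 1) :
    costCount n M k = costCount n M (k + 1) + clusterCount n M k := by
  classical
  rw [← card_insertionCost_eq n M k (0 + 1), ← card_lastEmpty_insertionCost hk hn,
    ← Finset.card_filter_add_card_filter_not (s := Finset.univ.filter _)
      (fun g : Fin n → Fin (M + 1) => (0 : Fin (M + 1)) ∈ occupied g n)]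
  rw [Finset.filter_filter, Finset.filter_filter]
  congr 1
  · rw [costCount]
    congr 1
    ext g
    simp only [Finset.mem_filter, Finset.mem_univ, true_and]
    rw [insertionCost_zero_eq_succ_iff (exists_notMem_occupied g hn), and_comm]
  · symm
    refine card_filter_rotate 1 fun g => ?_
    have h0 : (0 : Fin (M + 1)) = Fin.last M + 1 := by simp
    rw [insertionCost_add (mem_occupied_add g 1 n) 0]
    nth_rw 3 [h0]
    rw [mem_occupied_add g 1 n, and_comm]

/-- Such a cost would need `M` occupied buckets, more than there are keys. -/
lemma costCount_self {n M : ℕ} (hn : n < M) : costCount n M M = 0 := by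
  rw [costCount, Finset.card_eq_zero, Finset.filter_eq_empty_iff]
  intro g _ hg
  have h1 := (insertionCost_zero_eq_iff g (hn.trans (Nat.lt_succ_self M)) (Fin.last M)).1 hg
  have h2 : Finset.Iio (Fin.last M) ⊆ occupied g n := fun v hv => h1.2 v (Finset.mem_Iio.1 hv)
  have h3 := Finset.card_le_card h2
  have h4 := card_occupied_le g n
  rw [Fin.card_Iio, Fin.val_last] at h3
  omega

theorem costCount_eq_sum {n M k : ℕ} (hk : k ≤ M) (hn : n < M) :
    costCount n M k = ∑ j ∈ Finset.Ico k M, clusterCount n M j := by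
  induction hk using Nat.decreasingInduction with
  | self => simp [costCount_self hn]
  | of_succ k hk ih =>
    rw [costCount_eq_add hk (by omega), ih, Finset.sum_eq_sum_Ico_succ_bot hk, add_comm]

/-! ### Prefixes -/

lemma occupied_congr {m n n' : ℕ} {h : Fin n → Fin m} {g : Fin n' → Fin m} :
    ∀ t, ∀ (h1 : t ≤ n) (h2 : t ≤ n'),
      (∀ j (hj : j < t), h ⟨j, hj.trans_le h1⟩ = g ⟨j, hj.trans_le h2⟩) →
        occupied h t = occupied g t := by
  intro t
  induction t with
  | zero => simp [occupied]
  | succ t ih =>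
    intro h1 h2 hj
    rw [occupied_succ h h1, occupied_succ g h2,
      ih (by omega) (by omega) fun j hjt => hj j (by omega), hj t (by omega)]

lemma card_filter_prod {α β : Type*} [Fintype α] [Fintype β] (p : α × β → Prop)
    [DecidablePred p] :
    (Finset.univ.filter p).card = ∑ a, (Finset.univ.filter fun b => p (a, b)).card := by
  simp only [Finset.card_filter]
  exact Fintype.sum_prod_type _

/-- The `r` later addresses are free, and by rotation each of the `M + 1` addresses of key `i`
contributes equally. -/
lemma card_displacement_eq (M k i r : ℕ) (hi : i < i + 1 + r) :
    (Finset.univ.filter fun h : Fin (i + 1 + r) → Fin (M + 1) =>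
      displacement h ⟨i, hi⟩ = k).card = (M + 1) ^ r * ((M + 1) * costCount i M k) := by
  classical
  let e : ((Fin (M + 1)) × (Fin i → Fin (M + 1))) × (Fin r → Fin (M + 1)) ≃
      (Fin (i + 1 + r) → Fin (M + 1)) :=
    ((Fin.snocEquiv fun _ => Fin (M + 1)).prodCongr (Equiv.refl _)).trans (Fin.appendEquiv _ _)
  have he : ∀ u, displacement (e u) ⟨i, hi⟩ = insertionCost (occupied u.1.2 i) u.1.1 := by
    rintro ⟨⟨x, g⟩, v⟩
    have h1 : ∀ j (hj : j < i + 1), e ((x, g), v) ⟨j, by omega⟩ =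
        Fin.snoc (α := fun _ => Fin (M + 1)) g x ⟨j, hj⟩ := fun j hj =>
      Fin.append_left (Fin.snoc (α := fun _ => Fin (M + 1)) g x) v ⟨j, hj⟩
    have h2 : e ((x, g), v) ⟨i, hi⟩ = x := by
      rw [h1 i (by omega)]
      exact Fin.snoc_last (α := fun _ => Fin (M + 1)) x g
    have h3 : occupied (e ((x, g), v)) i = occupied g i := by
      refine occupied_congr i (by omega) le_rfl fun j hj => ?_
      rw [h1 j (by omega)]
      exact Fin.snoc_castSucc (α := fun _ => Fin (M + 1)) x g ⟨j, hj⟩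
    rw [displacement, h2, h3]
  rw [← Finset.card_equiv (s := (Finset.univ.filter fun u : Fin (M + 1) × (Fin i → Fin (M + 1)) =>
    insertionCost (occupied u.2 i) u.1 = k) ×ˢ
      (Finset.univ : Finset (Fin r → Fin (M + 1)))) e fun u => by simp [he]]
  rw [Finset.card_product, Finset.card_univ, Fintype.card_fun, Fintype.card_fin, Fintype.card_fin,
    mul_comm]
  congr 1
  rw [card_filter_prod, Finset.sum_congr rfl fun x _ => card_insertionCost_eq i M k x]
  simp

/-! ### Almost full tables -/

lemma isAlmostFull_iff {M : ℕ} (h : Fin M → Fin (M + 1)) :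
    IsAlmostFull h ↔ Fin.last M ∉ occupied h M := by
  have hc := card_occupied h M le_rfl (Nat.le_succ M)
  constructor
  · rintro ⟨_, h2⟩ h3
    simpa using (h2 _).1 h3
  · intro h1
    refine ⟨Nat.succ_pos _, fun x => ?_⟩
    have h2 : occupied h M ⊆ Finset.univ.erase (Fin.last M) := fun y hy =>
      Finset.mem_erase.2 ⟨fun hyl => h1 (hyl ▸ hy), Finset.mem_univ _⟩
    have h3 := Finset.eq_of_subset_of_card_le h2 (by simp [hc])
    rw [h3]
    simp [Fin.ext_iff]

lemma succ_eq_of_isAlmostFull {m n : ℕ} {h : Fin n → Fin m} (hh : IsAlmostFull h) :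
    n + 1 = m := by
  obtain ⟨hm, hh⟩ := hh
  obtain ⟨M, rfl⟩ : ∃ M, m = M + 1 := ⟨m - 1, by omega⟩
  have h1 : occupied h n = Finset.univ.erase (Fin.last M) := by
    ext x
    rw [hh]
    simp [Fin.ext_iff]
  have h2 : (occupied h n).card = M := by rw [h1]; simp
  have h3 := card_occupied_le h n
  by_contra hne
  -- With this many keys the first `M + 1` would already fill the table.
  have hn : M < n := by omega
  have h4 := card_occupied h (M + 1) (by omega) (by omega)
  have h5 := Finset.card_le_card (occupied_mono h (show M + 1 ≤ n from hn))
  omega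

open Classical in
lemma countFC_eq_sum (M k : ℕ) :
    countFC (M + 1) M k = ∑ i : Fin M, (Finset.univ.filter fun h : Fin M → Fin (M + 1) =>
      Fin.last M ∉ occupied h M ∧ displacement h i = k).card := by
  have : {p : (Fin M → Fin (M + 1)) × Fin M | IsAlmostFull p.1 ∧ displacement p.1 p.2 = k} =
      ((Finset.univ.filter fun p : (Fin M → Fin (M + 1)) × Fin M =>
        Fin.last M ∉ occupied p.1 M ∧ displacement p.1 p.2 = k : Finset _) : Set _) := by
    ext p
    simp [isAlmostFull_iff]
  rw [countFC, this, Set.ncard_coe_finset, ← Finset.card_equiv (Equiv.prodComm _ _)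
    (s := Finset.univ.filter fun p : Fin M × (Fin M → Fin (M + 1)) =>
        Fin.last M ∉ occupied p.2 M ∧ displacement p.2 p.1 = k) fun p => by simp]
  rw [card_filter_prod]

/-- Each table has exactly one empty bucket, and rotations, which preserve displacements, bring it
to any given place. -/
lemma succ_mul_card_lastEmpty_displacement (M k : ℕ) (i : Fin M) :
    (M + 1) * (Finset.univ.filter fun h : Fin M → Fin (M + 1) =>
      Fin.last M ∉ occupied h M ∧ displacement h i = k).card =
    (Finset.univ.filter fun h : Fin M → Fin (M + 1) => displacement h i = k).card := by
  classical
  have h1 := Finset.sum_card_bipartiteAbove_eq_sum_card_bipartiteBelow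
    (s := (Finset.univ : Finset (Fin (M + 1))))
    (t := Finset.univ.filter fun h : Fin M → Fin (M + 1) => displacement h i = k)
    (fun x h => x ∉ occupied h M)
  have h2 : ∀ x ∈ (Finset.univ : Finset (Fin (M + 1))), (Finset.bipartiteAbove
      (fun x (h : Fin M → Fin (M + 1)) => x ∉ occupied h M)
        (Finset.univ.filter fun h : Fin M → Fin (M + 1) => displacement h i = k) x).card =
        (Finset.univ.filter fun h : Fin M → Fin (M + 1) =>
          Fin.last M ∉ occupied h M ∧ displacement h i = k).card := fun x _ => by
    rw [Finset.bipartiteAbove, Finset.filter_filter]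
    refine card_filter_rotate (Fin.last M - x) fun h => ?_
    rw [displacement_add, ← mem_occupied_add h (Fin.last M - x), add_sub_cancel, and_comm]
  have h3 : ∀ h ∈ (Finset.univ.filter fun h : Fin M → Fin (M + 1) => displacement h i = k),
      (Finset.bipartiteBelow
      (fun x (h : Fin M → Fin (M + 1)) => x ∉ occupied h M) Finset.univ h).card = 1 :=
    fun h _ => by
      have h4 : Finset.bipartiteBelow (fun x (h : Fin M → Fin (M + 1)) => x ∉ occupied h M)
          Finset.univ h = (occupied h M)ᶜ := by
        ext x; simp [Finset.bipartiteBelow]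
      rw [h4, Finset.card_compl, card_occupied h M le_rfl (Nat.le_succ M), Fintype.card_fin]
      omega
  rw [Finset.sum_congr rfl h2, Finset.sum_congr rfl h3] at h1
  simpa using h1

theorem countFC_eq_sum_costCount (M k : ℕ) :
    countFC (M + 1) M k = ∑ i ∈ Finset.range M, (M + 1) ^ (M - 1 - i) * costCount i M k := by
  classical
  rw [countFC_eq_sum, Finset.sum_range]
  refine Finset.sum_congr rfl fun i _ => ?_
  apply Nat.eq_of_mul_eq_mul_left (Nat.succ_pos M)
  rw [Nat.succ_eq_add_one]
  refine Eq.trans ?_ ((succ_mul_card_lastEmpty_displacement M k i).trans ?_)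
  · congr!
  · obtain ⟨i, hi⟩ := i
    -- The number of keys is kept variable so that it can be replaced by `i + 1 + r` inside the
    -- types.
    have key : ∀ r N, N = i + 1 + r → ∀ hi : i < N,
        (Finset.univ.filter fun h : Fin N → Fin (M + 1) => displacement h ⟨i, hi⟩ = k).card =
          (M + 1) ^ r * ((M + 1) * costCount i M k) := by
      rintro r N rfl hi
      exact card_displacement_eq M k i r hi
    rw [key (M - 1 - i) M (by omega) hi]
    ring

/-! ### Full tables -/

lemma insertionCost_of_mem_iff {M : ℕ} {S : Finset (Fin (M + 1))}
    (hS : ∀ x, x ∈ S ↔ x ≠ Fin.last M) (x : Fin (M + 1)) : insertionCost S x = M - x := by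
  have hx : (x : ℕ) ≤ M := Nat.lt_succ_iff.1 x.2
  have hv : ∀ d, (x : ℕ) + d ≤ M → (probe x d : ℕ) = x + d := fun d hd => by
    simp [probe, Nat.mod_eq_of_lt (Nat.lt_succ_of_le hd)]
  rw [insertionCost_eq_iff ⟨Fin.last M, by simp [hS]⟩]
  simp only [hS, Ne, Fin.ext_iff, Fin.val_last]
  refine ⟨?_, fun d hd => ?_⟩
  · rw [hv _ (by omega)]; omega
  · rw [hv _ (by omega)]; omega

lemma mem_occupied_iff_ne_last {M n : ℕ} {h : Fin n → Fin (M + 1)} (hn : M ≤ n)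
    (hl : Fin.last M ∉ occupied h M) (x : Fin (M + 1)) :
    x ∈ occupied h M ↔ x ≠ Fin.last M := by
  have hc := card_occupied h M hn (Nat.le_succ M)
  have h2 : occupied h M ⊆ Finset.univ.erase (Fin.last M) := fun y hy =>
    Finset.mem_erase.2 ⟨fun hyl => hl (hyl ▸ hy), Finset.mem_univ _⟩
  have h3 := Finset.eq_of_subset_of_card_le h2 (by simp [hc])
  rw [h3]
  simp

lemma isFull_of_succ {M : ℕ} (h : Fin (M + 1) → Fin (M + 1)) : IsFull h := by
  refine ⟨rfl, fun x => ?_⟩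
  have h1 := card_occupied h (M + 1) le_rfl le_rfl
  rw [(Finset.card_eq_iff_eq_univ (occupied h (M + 1))).1 (by rw [h1, Fintype.card_fin])]
  exact Finset.mem_univ x

/-- The last key goes to the only bucket that the first `M` keys leave free. -/
lemma lastKeyInLastBucket_iff {M : ℕ} (h : Fin (M + 1) → Fin (M + 1)) :
    LastKeyInLastBucket h ↔ Fin.last M ∉ occupied h M := by
  have h1 : LastKeyInLastBucket h ↔ location h (Fin.last M) = Fin.last M := by
    constructor
    · rintro ⟨i, h1, h2⟩
      obtain rfl : i = Fin.last M := Fin.ext (by simpa using h1)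
      exact Fin.ext (by simpa using h2)
    · intro h1
      exact ⟨Fin.last M, by simp, by simp [h1]⟩
  rw [h1]
  have h2 : occupied h (M + 1) = insert (location h (Fin.last M)) (occupied h M) :=
    occupied_succ h (Nat.lt_succ_self M)
  have h3 : location h (Fin.last M) ∉ occupied h M :=
    probe_insertionCost_notMem (exists_notMem_occupied h (Nat.lt_succ_self M)) _
  constructor
  · intro h4
    rwa [h4] at h3
  · intro h4
    have h5 := (isFull_of_succ h).2 (Fin.last M)
    rw [h2, Finset.mem_insert] at h5
    exact (h5.resolve_right h4).symm

/-- Removing the last key leaves an almost full table, and its address `x` is arbitrary. A marked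
earlier key gives the first term. A marked last key has displacement `M - x`, which takes each value
up to `M` once. -/
theorem countFC₀_eq (M k : ℕ) :
    countFC₀ (M + 1) (M + 1) k =
      (M + 1) * countFC (M + 1) M k + if k ≤ M then lastEmptyCount (Fin M) M else 0 := by
  classical
  have h0 : {p : (Fin (M + 1) → Fin (M + 1)) × Fin (M + 1) | IsFull p.1 ∧
      LastKeyInLastBucket p.1 ∧ displacement p.1 p.2 = k} =
      ((Finset.univ.filter fun p : (Fin (M + 1) → Fin (M + 1)) × Fin (M + 1) =>
        Fin.last M ∉ occupied p.1 M ∧ displacement p.1 p.2 = k : Finset _) : Set _) := by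
    ext p
    simp [isFull_of_succ, lastKeyInLastBucket_iff]
  let e : (Fin (M + 1)) × (Fin M → Fin (M + 1)) ≃ (Fin (M + 1) → Fin (M + 1)) :=
    Fin.snocEquiv fun _ => Fin (M + 1)
  have e1 : ∀ u t, t ≤ M → occupied (e u) t = occupied u.2 t := by
    rintro ⟨x, g⟩ t ht
    refine occupied_congr t (by omega) ht fun j hj => ?_
    exact Fin.snoc_castSucc (α := fun _ => Fin (M + 1)) x g ⟨j, by omega⟩
  have e2 : ∀ u (i : Fin M), displacement (e u) i.castSucc = displacement u.2 i := by
    rintro ⟨x, g⟩ i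
    rw [displacement, displacement, Fin.val_castSucc, e1 _ _ i.2.le]
    congr 1
    exact Fin.snoc_castSucc (α := fun _ => Fin (M + 1)) x g i
  have e3 : ∀ u, Fin.last M ∉ occupied u.2 M → displacement (e u) (Fin.last M) = M - u.1 := by
    rintro ⟨x, g⟩ hu
    have h1 : e (x, g) (Fin.last M) = x := Fin.snoc_last (α := fun _ => Fin (M + 1)) x g
    rw [displacement, h1, Fin.val_last, e1 _ _ le_rfl]
    exact insertionCost_of_mem_iff (mem_occupied_iff_ne_last le_rfl hu) x
  rw [countFC₀, h0, Set.ncard_coe_finset, ← Finset.card_equiv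
    ((Equiv.prodComm (Fin (M + 1)) _).trans (e.prodCongr (Equiv.refl (Fin (M + 1)))))
    (s := Finset.univ.filter fun p : Fin (M + 1) × (Fin (M + 1) × (Fin M → Fin (M + 1))) =>
        Fin.last M ∉ occupied p.2.2 M ∧ displacement (e p.2) p.1 = k) fun p => by simp [e1],
    card_filter_prod, Fin.sum_univ_castSucc, countFC_eq_sum, Finset.mul_sum]
  congr 1
  · refine Finset.sum_congr rfl fun i _ => ?_
    simp only [e2]
    rw [card_filter_prod]
    simp
  · have h4 : (Finset.univ.filter fun u : Fin (M + 1) × (Fin M → Fin (M + 1)) =>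
        Fin.last M ∉ occupied u.2 M ∧ displacement (e u) (Fin.last M) = k) =
        (Finset.univ.filter fun x : Fin (M + 1) => M - (x : ℕ) = k) ×ˢ
          (Finset.univ.filter fun g : Fin M → Fin (M + 1) => Fin.last M ∉ occupied g M) := by
      ext u
      simp only [Finset.mem_filter, Finset.mem_univ, true_and, Finset.mem_product]
      constructor
      · rintro ⟨h1, h2⟩
        exact ⟨by rw [← h2, e3 u h1], h1⟩
      · rintro ⟨h1, h2⟩
        exact ⟨h2, by rw [← h1, e3 u h2]⟩
    rw [h4, Finset.card_product, ← lastEmptyCount_fin]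
    split_ifs with hk
    · have : (Finset.univ.filter fun x : Fin (M + 1) => M - (x : ℕ) = k) =
          {⟨M - k, by omega⟩} := by
        ext x
        have := x.2
        simp only [Finset.mem_filter, Finset.mem_univ, true_and, Finset.mem_singleton,
          Fin.ext_iff]
        omega
      rw [this, Finset.card_singleton, one_mul]
    · rw [Finset.filter_false_of_mem fun x _ => by omega, Finset.card_empty, zero_mul]

/-! ### Closed forms -/

lemma cast_lastEmptyCount {n L : ℕ} (hn : n ≤ L + 1) :
    (lastEmptyCount (Fin n) L : ℚ) = ((L : ℚ) + 1 - n) * ((L : ℚ) + 1) ^ n / ((L : ℚ) + 1) := by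
  have h := succ_mul_lastEmptyCount hn
  have h' : ((L : ℚ) + 1) * lastEmptyCount (Fin n) L = ((L : ℚ) + 1 - n) * ((L : ℚ) + 1) ^ n := by
    have := congrArg (Nat.cast : ℕ → ℚ) h
    push_cast [Nat.cast_sub hn] at this
    exact this
  have hL : (L : ℚ) + 1 ≠ 0 := by positivity
  rw [eq_div_iff hL, mul_comm, h']

lemma costCount_of_lt {n M k : ℕ} (hn : n < M) (hk : M < k) : costCount n M k = 0 := by
  rw [costCount, Finset.card_eq_zero, Finset.filter_eq_empty_iff]
  rintro g _ rfl
  obtain ⟨y, hy⟩ := exists_notMem_occupied g (hn.trans (Nat.lt_succ_self M))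
  have hp : probe 0 (y : ℕ) = y := by
    apply Fin.ext
    simp [probe, Nat.mod_eq_of_lt y.2]
  have := insertionCost_le (S := occupied g n) (x := 0) (d := y) (by rwa [hp])
  have := y.2
  omega

/-- Here `a` and `s` are the numbers of buckets and keys beyond bucket `j`; the dependence on `s` is
isolated for the summation. -/
lemma cast_clusterCount {s a j : ℕ} (hs : s < a) :
    (clusterCount (j + s) (j + a) j : ℚ) =
      ((j : ℚ) + 1) ^ j / ((j : ℚ) + 1) / a *
        ((j + s).choose j * ((a : ℚ) - s) * (a : ℚ) ^ s) := by
  obtain ⟨L, rfl⟩ : ∃ L, a = L + 1 := ⟨a - 1, by omega⟩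
  have h1 : j + s - j = s := by omega
  have h2 : j + (L + 1) - 1 - j = L := by omega
  rw [clusterCount, h1, h2]
  push_cast
  rw [cast_lastEmptyCount (Nat.le_succ j), cast_lastEmptyCount (by omega)]
  ring

lemma choose_succ_mul_succ (j s : ℕ) :
    ((j + (s + 1)).choose j : ℚ) * (s + 1) = (j + s).choose j * (j + s + 1) := by
  have h := Nat.add_one_mul_choose_eq (j + s) s
  rw [Nat.choose_symm_add, Nat.choose_symm_add]
  have := congrArg (Nat.cast : ℕ → ℚ) h
  push_cast at this
  rw [show j + (s + 1) = j + s + 1 by ring]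
  linarith

/-- The right-hand sides have the summands as differences because `(j + s + 1) a - s (j + a + 1) =
(j + 1)(a - s)`. -/
lemma sum_telescope (j a : ℕ) :
    ∀ s ≤ a, ((j : ℚ) + 1) * ∑ i ∈ Finset.range s, ((j : ℚ) + a + 1) ^ (a - 1 - i) *
        ((j + i).choose j * ((a : ℚ) - i) * (a : ℚ) ^ i) =
      (j + s).choose j * s * (a : ℚ) ^ s * ((j : ℚ) + a + 1) ^ (a - s) := by
  intro s
  induction s with
  | zero => simp
  | succ s ih =>
    intro hs
    have e1 : a - s = (a - 1 - s) + 1 := by omega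
    have e2 : a - (s + 1) = a - 1 - s := by omega
    have h := choose_succ_mul_succ j s
    rw [Finset.sum_range_succ, mul_add, ih (by omega), e1, e2]
    push_cast
    rw [h]
    ring

/-- Fewer than `j` keys cannot form the cluster, so only `i ≥ j` contributes, and that part
telescopes. -/
lemma sum_mul_clusterCount (M j : ℕ) (hj : j < M) :
    ∑ i ∈ Finset.range M, ((M : ℚ) + 1) ^ (M - 1 - i) * clusterCount i M j =
      ((j : ℚ) + 1) ^ j / ((j : ℚ) + 1) ^ 2 * (M.choose j * ((M - j : ℕ) : ℚ) ^ (M - j)) := by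
  obtain ⟨a, rfl⟩ : ∃ a, M = j + a := ⟨M - j, by omega⟩
  have ha : (a : ℚ) ≠ 0 := by
    have : a ≠ 0 := by omega
    exact_mod_cast this
  have hj1 : (j : ℚ) + 1 ≠ 0 := by positivity
  have h0 : ∀ i ∈ Finset.range j, (((j + a : ℕ) : ℚ) + 1) ^ (j + a - 1 - i) *
      (clusterCount i (j + a) j : ℚ) = 0 := fun i hi => by
    rw [clusterCount, Nat.choose_eq_zero_of_lt (Finset.mem_range.1 hi)]
    simp
  have h1 : ∀ i ∈ Finset.range a, (((j + a : ℕ) : ℚ) + 1) ^ (j + a - 1 - (j + i)) *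
      (clusterCount (j + i) (j + a) j : ℚ) = ((j : ℚ) + 1) ^ j / ((j : ℚ) + 1) / a *
        (((j : ℚ) + a + 1) ^ (a - 1 - i) * ((j + i).choose j * ((a : ℚ) - i) * (a : ℚ) ^ i)) :=
    fun i hi => by
      rw [cast_clusterCount (Finset.mem_range.1 hi), show j + a - 1 - (j + i) = a - 1 - i by omega]
      push_cast
      ring
  have h2 := sum_telescope j a a le_rfl
  rw [Finset.sum_range_add, Finset.sum_eq_zero h0, zero_add, Finset.sum_congr rfl h1,
    ← Finset.mul_sum]
  rw [mul_comm, ← eq_div_iff hj1] at h2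
  rw [h2, Nat.sub_self, Nat.add_sub_cancel_left]
  field_simp

theorem cast_countFC (M k : ℕ) :
    (countFC (M + 1) M k : ℚ) = ∑ j ∈ Finset.Ico k M,
      ((j : ℚ) + 1) ^ j / ((j : ℚ) + 1) ^ 2 * (M.choose j * ((M - j : ℕ) : ℚ) ^ (M - j)) := by
  have h : ∀ i ∈ Finset.range M, costCount i M k = ∑ j ∈ Finset.Ico k M, clusterCount i M j := by
    intro i hi
    rw [Finset.mem_range] at hi
    rcases le_or_gt k M with hk | hk
    · exact costCount_eq_sum hk hi
    · rw [costCount_of_lt hi hk, Finset.Ico_eq_empty (by omega), Finset.sum_empty]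
  rw [countFC_eq_sum_costCount, Finset.sum_congr rfl fun i hi => by rw [h i hi, Finset.mul_sum],
    Finset.sum_comm]
  push_cast
  exact Finset.sum_congr rfl fun j hj => sum_mul_clusterCount M j (Finset.mem_Ico.1 hj).2

/-- The coefficients of the exponential generating function of unrooted labelled trees. -/
def treeCoeff (n : ℕ) : ℚ := (n : ℚ) ^ n / ((n : ℚ) ^ 2 * n !)

/-- The coefficients of the exponential generating function of all self-maps. -/
def mapCoeff (n : ℕ) : ℚ := (n : ℚ) ^ n / n !

/-- The term `j` of `cast_countFC` corresponds to `p = (j + 1, M - j)`; `j < M` excludes `p.2 = 0`.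
-/
theorem countFC_div_factorial (M k : ℕ) :
    (countFC (M + 1) M k : ℚ) / M ! = ∑ p ∈ Finset.HasAntidiagonal.antidiagonal (M + 1),
      (if k < p.1 then treeCoeff p.1 else 0) * (if p.2 = 0 then 0 else mapCoeff p.2) := by
  rw [Finset.Nat.sum_antidiagonal_eq_sum_range_succ_mk, Finset.sum_range_succ,
    Finset.sum_range_succ']
  simp only [Nat.sub_self, if_true, mul_zero, add_zero, Nat.not_lt_zero, if_false, zero_mul,
    Nat.add_sub_add_right]
  rw [cast_countFC, Finset.sum_div]
  have hsub : Finset.Ico k M ⊆ Finset.range M := fun j hj => by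
    simp only [Finset.mem_Ico, Finset.mem_range] at hj ⊢
    exact hj.2
  symm
  rw [← Finset.sum_subset hsub fun j hj hj' => by
    simp only [Finset.mem_Ico, Finset.mem_range] at hj hj'
    rw [if_neg (by omega), zero_mul]]
  refine Finset.sum_congr rfl fun j hj => ?_
  rw [Finset.mem_Ico] at hj
  rw [if_pos (by omega), if_neg (by omega), treeCoeff, mapCoeff,
    Nat.cast_choose ℚ hj.2.le, Nat.factorial_succ]
  have h1 : (j : ℚ) + 1 ≠ 0 := by positivity
  have h2 : (j ! : ℚ) ≠ 0 := by positivity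
  have h3 : ((M - j)! : ℚ) ≠ 0 := by positivity
  have h4 : (M ! : ℚ) ≠ 0 := by positivity
  push_cast
  field_simp
  ring

/-- The extra term of `countFC₀_eq`, for a marked last key, is exactly the summand with `p.2 = 0`,
where `mapCoeff 0 = 1`. -/
theorem countFC₀_div_factorial (n k : ℕ) :
    (countFC₀ n n k : ℚ) / n ! = ∑ p ∈ Finset.HasAntidiagonal.antidiagonal n,
      (if k < p.1 then treeCoeff p.1 else 0) * mapCoeff p.2 := by
  rcases n with _ | M
  · have : countFC₀ 0 0 k = 0 := by
      rw [countFC₀, Set.eq_empty_of_isEmpty {p : (Fin 0 → Fin 0) × Fin 0 | _}, Set.ncard_empty]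
    simp [this]
  · have h := countFC_div_factorial M k
    have hM : ((M : ℚ) + 1) ≠ 0 := by positivity
    have hf : (M ! : ℚ) ≠ 0 := by positivity
    rw [countFC₀_eq, Nat.factorial_succ]
    push_cast
    rw [add_div, mul_div_mul_left _ _ hM, h]
    rw [Finset.Nat.sum_antidiagonal_eq_sum_range_succ_mk,
      Finset.Nat.sum_antidiagonal_eq_sum_range_succ_mk, Finset.sum_range_succ,
      Finset.sum_range_succ (n := M + 1)]
    congr 1
    · simp only [Nat.sub_self, if_true, mul_zero, add_zero]
      refine Finset.sum_congr rfl fun j hj => ?_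
      rw [Finset.mem_range] at hj
      rw [if_neg (show ¬ M + 1 - j = 0 by omega)]
    · have h1 : mapCoeff (M + 1 - (M + 1)) = 1 := by simp [mapCoeff]
      simp only [h1, mul_one, Nat.lt_succ_iff]
      split_ifs
      · rw [cast_lastEmptyCount (Nat.le_succ M), treeCoeff, Nat.factorial_succ]
        push_cast
        field_simp
        ring
      · simp

/-! ### An identity of Abel -/

open Polynomial in
-- Induction on `m`: differentiation reduces to the previous case, and the value at `0` vanishes as
-- a finite difference of order `m + 2` of `x^(m+1)`.
lemma abel_polynomial_identity (m : ℕ) :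
    ∑ j ∈ Finset.range (m + 1), C (((m + 1).choose (j + 1) : ℚ) * ((j : ℚ) + 1) ^ j) *
      (X - C ((j : ℚ) + 1)) ^ (m - j) = C ((m : ℚ) + 1) * X ^ m := by
  induction m with
  | zero => simp
  | succ m ih =>
    rw [← sub_eq_zero]
    set p : ℚ[X] := _ - _ with hp
    have hd : derivative p = 0 := by
      rw [hp, derivative_sub, derivative_sum, Finset.sum_range_succ, sub_eq_zero]
      have : ∀ j ∈ Finset.range (m + 1),
          derivative (C (((m + 1 + 1).choose (j + 1) : ℚ) * ((j : ℚ) + 1) ^ j) *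
            (X - C ((j : ℚ) + 1)) ^ (m + 1 - j)) = C ((m : ℚ) + 2) *
          (C (((m + 1).choose (j + 1) : ℚ) * ((j : ℚ) + 1) ^ j) *
            (X - C ((j : ℚ) + 1)) ^ (m - j)) := by
        intro j hj
        have hjm : j ≤ m := Nat.lt_succ_iff.1 (Finset.mem_range.1 hj)
        have e1 : m + 1 - j = (m - j) + 1 := by omega
        have e2 : ((m + 1 + 1).choose (j + 1) : ℚ) * ((m - j : ℕ) + 1) =
            (m + 2) * (m + 1).choose (j + 1) := by
          have h := Nat.choose_mul_succ_eq (m + 1) (j + 1)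
          rw [show m + 1 + 1 - (j + 1) = m - j + 1 by omega] at h
          have h' := congrArg (Nat.cast : ℕ → ℚ) h
          push_cast at h' ⊢
          linarith
        rw [e1, derivative_C_mul, derivative_X_sub_C_pow, Nat.add_sub_cancel, ← mul_assoc,
          ← mul_assoc, ← C_mul, ← C_mul]
        congr 2
        push_cast
        linear_combination ((j : ℚ) + 1) ^ j * e2
      rw [Finset.sum_congr rfl this, ← Finset.mul_sum, ih, Nat.sub_self, pow_zero, mul_one,
        derivative_C, add_zero, derivative_C_mul_X_pow]
      rw [← mul_assoc, ← C_mul]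
      push_cast
      congr 2
      ring
    have h0 : p.eval 0 = 0 := by
      have hf := congrFun (fwdDiff_iter_pow_eq_zero_of_lt (R := ℚ) (Nat.lt_succ_self (m + 1))) 0
      rw [fwdDiff_iter_eq_sum_shift, Finset.sum_range_succ'] at hf
      rw [hp, eval_sub, eval_finsetSum]
      simp only [eval_mul, eval_C, eval_pow, eval_sub, eval_X, zero_sub, ne_eq,
        Nat.succ_ne_zero, not_false_eq_true, zero_pow, mul_zero, sub_zero]
      simp only [nsmul_eq_mul, mul_one, zero_add, zsmul_eq_mul, Nat.cast_zero, ne_eq,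
        Nat.succ_ne_zero, not_false_eq_true, zero_pow, mul_zero, add_zero, Pi.zero_apply] at hf
      rw [← hf]
      refine Finset.sum_congr rfl fun j hj => ?_
      have hjm : j ≤ m + 1 := Nat.lt_succ_iff.1 (Finset.mem_range.1 hj)
      obtain ⟨r, hr⟩ : ∃ r, m + 1 = j + r := ⟨m + 1 - j, by omega⟩
      have e1 : m + 1 - j = r := by omega
      have e2 : (m + 1).succ - (j + 1) = r := by omega
      have e3 : ((j : ℚ) + 1) ^ (m + 1) = (j + 1) ^ j * (j + 1) ^ r := by rw [hr, pow_add]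
      rw [e1, e2, neg_pow]
      push_cast
      rw [e3, Nat.succ_eq_add_one]
      ring
    have h1 := eq_C_of_derivative_eq_zero hd
    rw [h1, eval_C] at h0
    rw [h1, h0, C_0]

lemma abel_identity (m : ℕ) :
    ∑ j ∈ Finset.range (m + 1), ((m + 1).choose (j + 1) : ℚ) * ((j : ℚ) + 1) ^ j *
      ((m - j : ℕ) : ℚ) ^ (m - j) = ((m : ℚ) + 1) ^ (m + 1) := by
  have h := congrArg (Polynomial.eval ((m : ℚ) + 1)) (abel_polynomial_identity m)
  rw [Polynomial.eval_finsetSum] at h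
  simp only [Polynomial.eval_mul, Polynomial.eval_C, Polynomial.eval_pow, Polynomial.eval_sub,
    Polynomial.eval_X] at h
  rw [pow_succ', ← h]
  refine Finset.sum_congr rfl fun j hj => ?_
  rw [Nat.cast_sub (Nat.lt_succ_iff.1 (Finset.mem_range.1 hj))]
  congr 2
  ring

/-! ### The tree function -/

/-- The exponential generating function of all self-maps. -/
def mapSeries : PowerSeries ℚ := PowerSeries.mk mapCoeff

/-- The exponential generating function of unrooted labelled trees. -/
def unrootedTreeSeries : PowerSeries ℚ := PowerSeries.mk treeCoeff

lemma coeff_succ_treeFunction (n : ℕ) :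
    PowerSeries.coeff (n + 1) treeFunction = ((n : ℚ) + 1) ^ n / (n + 1)! := by
  simp [treeFunction]

lemma coeff_zero_treeFunction : PowerSeries.coeff 0 treeFunction = 0 := by
  simp [treeFunction]

/-- Coefficientwise this is Abel's identity. -/
theorem mapSeries_eq : mapSeries = 1 + treeFunction * mapSeries := by
  ext n
  rcases n with _ | m
  · simp [mapSeries, mapCoeff, treeFunction]
  · rw [map_add, PowerSeries.coeff_one, if_neg (Nat.succ_ne_zero m), zero_add,
      PowerSeries.coeff_mul, Finset.Nat.sum_antidiagonal_eq_sum_range_succ_mk,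
      Finset.sum_range_succ']
    simp only [coeff_zero_treeFunction, zero_mul, add_zero, coeff_succ_treeFunction, mapSeries,
      PowerSeries.coeff_mk, mapCoeff, Nat.add_sub_add_right]
    push_cast
    rw [← abel_identity, Finset.sum_div]
    refine Finset.sum_congr rfl fun j hj => ?_
    have hjm : j + 1 ≤ m + 1 := Finset.mem_range.1 hj
    rw [Nat.cast_choose ℚ hjm, Nat.add_sub_add_right]
    have h2 : ((j + 1)! : ℚ) ≠ 0 := by positivity
    have h3 : ((m - j)! : ℚ) ≠ 0 := by positivity
    have h4 : ((m + 1)! : ℚ) ≠ 0 := by positivity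
    field_simp

theorem one_sub_treeFunction_mul_mapSeries : (1 - treeFunction) * mapSeries = 1 := by
  linear_combination mapSeries_eq

lemma coeff_X_mul_derivative (f : PowerSeries ℚ) (n : ℕ) :
    PowerSeries.coeff n (PowerSeries.X * PowerSeries.derivative ℚ f) =
      n * PowerSeries.coeff n f := by
  rcases n with _ | n
  · simp
  · rw [PowerSeries.coeff_succ_X_mul, PowerSeries.coeff_derivative]
    push_cast
    ring

/-- With `D = x d/dx`, one has `D U = T` and `D T = B - 1 = T/(1 - T)`, hence `D(T - T²/2) = (1 - T)
D T = T` as well. -/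
theorem two_mul_unrootedTreeSeries :
    2 * unrootedTreeSeries = 2 * treeFunction - treeFunction ^ 2 := by
  have h1 : PowerSeries.X * PowerSeries.derivative ℚ unrootedTreeSeries = treeFunction := by
    ext n
    rw [coeff_X_mul_derivative]
    rcases n with _ | n
    · simp [treeFunction]
    · rw [coeff_succ_treeFunction, unrootedTreeSeries, PowerSeries.coeff_mk, treeCoeff]
      have : ((n : ℚ) + 1) ≠ 0 := by positivity
      push_cast
      field_simp
      ring
  have h2 : PowerSeries.X * PowerSeries.derivative ℚ treeFunction = mapSeries - 1 := by
    ext n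
    rw [coeff_X_mul_derivative]
    rcases n with _ | n
    · simp [mapSeries, mapCoeff]
    · rw [coeff_succ_treeFunction, map_sub, PowerSeries.coeff_one, if_neg (Nat.succ_ne_zero n),
        mapSeries, PowerSeries.coeff_mk, mapCoeff]
      push_cast
      ring
  refine PowerSeries.derivative.ext ?_ ?_
  · apply mul_left_cancel₀ (PowerSeries.X_ne_zero (R := ℚ))
    have h3 : PowerSeries.derivative ℚ (2 : PowerSeries ℚ) = 0 :=
      (PowerSeries.derivative ℚ).map_natCast 2
    rw [map_sub, Derivation.leibniz, Derivation.leibniz, Derivation.leibniz_pow, h3]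
    simp only [smul_eq_mul, nsmul_eq_mul, mul_zero, add_zero]
    push_cast
    linear_combination 2 * h1 + (2 * treeFunction - 2) * h2 +
      (-2) * one_sub_treeFunction_mul_mapSeries
  -- The constant terms agree since `treeCoeff 0 = 0`, by the convention for division by zero.
  · simp [unrootedTreeSeries, treeFunction, treeCoeff]

/-! ### Series in `z`, `w` and `q` -/

/-- Since `d 0 = 1`, the exponent of `z` determines the only power of the monomial that can
contribute. -/
lemma coeff_subst_monomial {d : Fin 3 →₀ ℕ} (hd : d 0 = 1) (f : PowerSeries ℚ)
    (e : Fin 3 →₀ ℕ) :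
    MvPowerSeries.coeff e (PowerSeries.subst (MvPowerSeries.monomial d (1 : ℚ)) f) =
      if e = e 0 • d then PowerSeries.coeff (e 0) f else 0 := by
  classical
  have hd0 : d ≠ 0 := by
    rintro rfl
    simp at hd
  rw [PowerSeries.coeff_subst (PowerSeries.HasSubst.monomial hd0 1), finsum_eq_single _ (e 0)]
  · rw [MvPowerSeries.monomial_pow, one_pow, MvPowerSeries.coeff_monomial]
    split_ifs <;> simp
  · intro n hn
    rw [MvPowerSeries.monomial_pow, one_pow, MvPowerSeries.coeff_monomial, if_neg, smul_zero]
    rintro rfl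
    simp [hd] at hn

/-- The exponent of `zw`. -/
def exponentZW : Fin 3 →₀ ℕ := Finsupp.single 0 1 + Finsupp.single 1 1

lemma zw_eq : z * w = MvPowerSeries.monomial exponentZW (1 : ℚ) := by
  rw [exponentZW, z, w, MvPowerSeries.X, MvPowerSeries.X, MvPowerSeries.monomial_mul_monomial,
    one_mul]

lemma zwq_eq :
    z * w * q = MvPowerSeries.monomial (exponentZW + Finsupp.single 2 1) (1 : ℚ) := by
  rw [zw_eq, q, MvPowerSeries.X, MvPowerSeries.monomial_mul_monomial, one_mul]

lemma ext_fin_three {e e' : Fin 3 →₀ ℕ} : e = e' ↔ e 0 = e' 0 ∧ e 1 = e' 1 ∧ e 2 = e' 2 := by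
  rw [Finsupp.ext_iff, Fin.forall_fin_succ, Fin.forall_fin_two]
  rfl

lemma coeff_subst_zw (f : PowerSeries ℚ) (e : Fin 3 →₀ ℕ) :
    MvPowerSeries.coeff e (PowerSeries.subst (z * w) f) =
      if e 0 = e 1 ∧ e 2 = 0 then PowerSeries.coeff (e 0) f else 0 := by
  rw [zw_eq, coeff_subst_monomial (by simp [exponentZW])]
  congr 1
  rw [ext_fin_three]
  simp [exponentZW, eq_comm]

lemma coeff_subst_zwq (f : PowerSeries ℚ) (e : Fin 3 →₀ ℕ) :
    MvPowerSeries.coeff e (PowerSeries.subst (z * w * q) f) =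
      if e 0 = e 1 ∧ e 2 = e 0 then PowerSeries.coeff (e 0) f else 0 := by
  rw [zwq_eq, coeff_subst_monomial (by simp [exponentZW])]
  congr 1
  rw [ext_fin_three]
  simp [exponentZW, eq_comm]

lemma coeff_X_mul_eq (s : Fin 3) (f : GF) (e : Fin 3 →₀ ℕ) :
    MvPowerSeries.coeff e (MvPowerSeries.X s * f) =
      if e s = 0 then 0 else MvPowerSeries.coeff (e - Finsupp.single s 1) f := by
  classical
  rw [MvPowerSeries.X, MvPowerSeries.coeff_monomial_mul, one_mul]
  simp only [Finsupp.single_le_iff, Nat.one_le_iff_ne_zero]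
  split_ifs <;> simp_all

/-- The series in `zw` and `q` with given coefficients. -/
def diagonalSeries (c : ℕ → ℕ → ℚ) : GF := fun e => if e 0 = e 1 then c (e 0) (e 2) else 0

lemma coeff_diagonalSeries (c : ℕ → ℕ → ℚ) (e : Fin 3 →₀ ℕ) :
    MvPowerSeries.coeff e (diagonalSeries c) = if e 0 = e 1 then c (e 0) (e 2) else 0 := rfl

/-- The exponent of `(zw)ⁿ qᵏ`. -/
def diagonalExponent (n k : ℕ) : Fin 3 →₀ ℕ := Finsupp.equivFunOnFinite.symm ![n, n, k]

lemma diagonalExponent_apply (n k : ℕ) : diagonalExponent n k 0 = n ∧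
    diagonalExponent n k 1 = n ∧ diagonalExponent n k 2 = k := ⟨rfl, rfl, rfl⟩

/-- The second factor is free of `q`, so a contributing pair of exponents is determined by its two
exponents of `z`. -/
lemma diagonalSeries_mul_subst (c : ℕ → ℕ → ℚ) (f : PowerSeries ℚ) :
    diagonalSeries c * PowerSeries.subst (z * w) f = diagonalSeries fun n k =>
      ∑ p ∈ Finset.HasAntidiagonal.antidiagonal n, c p.1 k * PowerSeries.coeff p.2 f := by
  classical
  ext e
  rw [MvPowerSeries.coeff_mul, coeff_diagonalSeries]
  simp only [coeff_diagonalSeries, coeff_subst_zw]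
  split_ifs with he
  · symm
    refine Finset.sum_of_injOn
      (fun p => (diagonalExponent p.1 (e 2), diagonalExponent p.2 0)) ?_ ?_ ?_ ?_
    · rintro ⟨a, b⟩ _ ⟨a', b'⟩ _ h
      rw [Prod.mk.injEq, ext_fin_three, ext_fin_three] at h
      exact Prod.ext h.1.1 h.2.1
    · rintro ⟨a, b⟩ h
      rw [Finset.mem_coe, Finset.HasAntidiagonal.mem_antidiagonal] at h ⊢
      rw [ext_fin_three]
      have h1 := diagonalExponent_apply a (e 2)
      have h2 := diagonalExponent_apply b 0
      simp only [Finsupp.add_apply, h1, h2]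
      simp only at h
      omega
    · rintro ⟨d, d'⟩ h hne
      rw [Finset.HasAntidiagonal.mem_antidiagonal] at h
      simp only at h ⊢
      by_cases h1 : d 0 = d 1
      · by_cases h2 : d' 0 = d' 1 ∧ d' 2 = 0
        · refine absurd ⟨(d 0, d' 0), ?_, ?_⟩ hne
          · rw [Finset.mem_coe, Finset.HasAntidiagonal.mem_antidiagonal, ← h]
            rfl
          · have h3 : e 2 = d 2 + d' 2 := by rw [← h]; rfl
            refine Prod.ext (ext_fin_three.2 ⟨rfl, h1, ?_⟩)
              (ext_fin_three.2 ⟨rfl, h2.1, h2.2.symm⟩)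
            change e 2 = d 2
            omega
        · rw [if_neg h2, mul_zero]
      · rw [if_neg h1, zero_mul]
    · rintro ⟨a, b⟩ _
      have h1 := diagonalExponent_apply a (e 2)
      have h2 := diagonalExponent_apply b 0
      simp [h1, h2]
  · refine Finset.sum_eq_zero ?_
    rintro ⟨d, d'⟩ h
    rw [Finset.HasAntidiagonal.mem_antidiagonal] at h
    simp only at h ⊢
    by_cases h1 : d 0 = d 1
    · rw [if_neg (c := d' 0 = d' 1 ∧ d' 2 = 0), mul_zero]
      rintro ⟨h2, _⟩
      refine he ?_
      rw [← h, Finsupp.add_apply, Finsupp.add_apply, h1, h2]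
    · rw [if_neg h1, zero_mul]

/-- The contribution of the last cluster: `(U(zw) - U(zwq)) / (1 - q)`, where `U` is the
exponential generating function of unrooted labelled trees. -/
def lastClusterSeries : GF := diagonalSeries fun n k => if k < n then treeCoeff n else 0

/-- Geometric sum: `(1 - q)(1 + ⋯ + q^(n-1)) = 1 - q^n`. -/
lemma one_sub_q_mul_lastClusterSeries :
    (1 - q) * lastClusterSeries = PowerSeries.subst (z * w) unrootedTreeSeries -
      PowerSeries.subst (z * w * q) unrootedTreeSeries := by
  ext e
  have h0 : treeCoeff 0 = 0 := by simp [treeCoeff]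
  have e1 : (e - Finsupp.single 2 1 : Fin 3 →₀ ℕ) 0 = e 0 := by simp
  have e2 : (e - Finsupp.single 2 1 : Fin 3 →₀ ℕ) 1 = e 1 := by simp
  have e3 : (e - Finsupp.single 2 1 : Fin 3 →₀ ℕ) 2 = e 2 - 1 := by simp
  rw [sub_mul, one_mul, map_sub, map_sub, coeff_X_mul_eq, coeff_subst_zw, coeff_subst_zwq,
    lastClusterSeries, coeff_diagonalSeries, coeff_diagonalSeries, e1, e2, e3,
    unrootedTreeSeries, PowerSeries.coeff_mk]
  by_cases h01 : e 0 = e 1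
  · simp only [h01, if_true, true_and]
    rcases Nat.eq_zero_or_pos (e 2) with h2 | h2
    · rcases Nat.eq_zero_or_pos (e 1) with h1 | h1
      · simp [h2, h1, h0]
      · simp [h2, h1, h1.ne]
    · rcases lt_trichotomy (e 2) (e 1) with h | h | h
      · rw [if_pos h, if_neg h2.ne', if_pos (by omega), if_neg h2.ne', if_neg h.ne]
        simp
      · rw [if_neg h.not_lt, if_neg h2.ne', if_pos (by omega), if_neg h2.ne', if_pos h]
      · rw [if_neg (by omega), if_neg h2.ne', if_neg (by omega), if_neg h2.ne', if_neg h.ne']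
  · simp [h01]

theorem FC₀_eq : FC₀ = lastClusterSeries * PowerSeries.subst (z * w) mapSeries := by
  rw [lastClusterSeries, diagonalSeries_mul_subst]
  ext e
  rw [coeff_diagonalSeries]
  change (countFC₀ (e 1) (e 0) (e 2) : ℚ) / (e 0)! = _
  split_ifs with h
  · rw [← h, countFC₀_div_factorial]
    simp [mapSeries]
  · have : countFC₀ (e 1) (e 0) (e 2) = 0 := by
      rw [countFC₀, Set.ncard_eq_zero (Set.toFinite _), Set.eq_empty_iff_forall_notMem]
      rintro p ⟨hp, _⟩
      exact h hp.1
    simp [this]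

/-- An almost full table has one key less than buckets; the factor `z` makes the exponents of `z`
and `w` equal. -/
theorem z_mul_FC_eq : z * FC = lastClusterSeries * PowerSeries.subst (z * w) (mapSeries - 1) := by
  rw [lastClusterSeries, diagonalSeries_mul_subst]
  ext e
  have e1 : (e - Finsupp.single 0 1 : Fin 3 →₀ ℕ) 0 = e 0 - 1 := by simp
  have e2 : (e - Finsupp.single 0 1 : Fin 3 →₀ ℕ) 1 = e 1 := by simp
  have e3 : (e - Finsupp.single 0 1 : Fin 3 →₀ ℕ) 2 = e 2 := by simp
  have hc : ∀ n, PowerSeries.coeff n (mapSeries - 1) = if n = 0 then 0 else mapCoeff n := by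
    intro n
    rw [map_sub, PowerSeries.coeff_one, mapSeries, PowerSeries.coeff_mk]
    rcases n with _ | n <;> simp [mapCoeff]
  simp only [hc]
  rw [coeff_diagonalSeries, coeff_X_mul_eq]
  by_cases h0 : e 0 = 0
  · rw [if_pos h0]
    split_ifs
    · rw [h0]
      simp
    · rfl
  · rw [if_neg h0]
    change (countFC _ _ _ : ℚ) / _ = _
    rw [e1, e2, e3]
    obtain ⟨M, hM⟩ : ∃ M, e 0 = M + 1 := ⟨e 0 - 1, by omega⟩
    rw [hM, Nat.add_sub_cancel]
    split_ifs with h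
    · rw [← h, countFC_div_factorial]
    · have : countFC (e 1) M (e 2) = 0 := by
        rw [countFC, Set.ncard_eq_zero (Set.toFinite _), Set.eq_empty_iff_forall_notMem]
        rintro p ⟨hp, _⟩
        exact h (succ_eq_of_isAlmostFull hp)
      simp [this]

lemma ne_zero_of_constantCoeff {f : GF} (hf : MvPowerSeries.constantCoeff f ≠ 0) : f ≠ 0 := by
  rintro rfl
  simp at hf

lemma one_sub_T_ne_zero : 1 - T (z * w) ≠ 0 := by
  apply ne_zero_of_constantCoeff
  rw [map_sub, T, ← MvPowerSeries.coeff_zero_eq_constantCoeff_apply,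
    ← MvPowerSeries.coeff_zero_eq_constantCoeff_apply, coeff_subst_zw]
  simp [coeff_zero_treeFunction]

end LinearProbing
end

open LinearProbing

theorem mainTheorem11 :
    ι FC =
        ι (((1 - T (z * w * q)) ^ 2 - (1 - T (z * w)) ^ 2) * T (z * w)) /
          ι (2 * z * (1 - q) * (1 - T (z * w))) ∧
    ι FC₀ =
        ι ((1 - T (z * w * q)) ^ 2 - (1 - T (z * w)) ^ 2) /
          ι (2 * (1 - q) * (1 - T (z * w))) := by
  have hι : Function.Injective ι := IsFractionRing.injective GF (FractionRing GF)
  have hz : z ≠ 0 := fun h => by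
    have h1 : MvPowerSeries.coeff (Finsupp.single 0 1) z = 1 :=
      MvPowerSeries.coeff_index_single_self_X 0
    rw [h] at h1
    simp at h1
  have hq : 1 - q ≠ 0 := ne_zero_of_constantCoeff (by simp)
  have h2 : (2 : GF) ≠ 0 := ne_zero_of_constantCoeff (by rw [map_ofNat]; norm_num)
  have hs1 : PowerSeries.HasSubst (z * w) := PowerSeries.HasSubst.of_constantCoeff_zero (by simp)
  have hs2 : PowerSeries.HasSubst (z * w * q) :=
    PowerSeries.HasSubst.of_constantCoeff_zero (by simp)
  have hU : ∀ {a : GF}, PowerSeries.HasSubst a →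
      2 * PowerSeries.subst a unrootedTreeSeries = 2 * T a - T a ^ 2 := fun {a} ha => by
    have h := congrArg (PowerSeries.substAlgHom (R := ℚ) ha) two_mul_unrootedTreeSeries
    simp only [map_mul, map_sub, map_pow, map_ofNat] at h
    simpa [PowerSeries.coe_substAlgHom, T] using h
  have hB : (1 - T (z * w)) * PowerSeries.subst (z * w) mapSeries = 1 := by
    have h := congrArg (PowerSeries.substAlgHom (R := ℚ) hs1) one_sub_treeFunction_mul_mapSeries
    simp only [map_mul, map_sub, map_one] at h
    simpa [PowerSeries.coe_substAlgHom, T] using h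
  have hB' : PowerSeries.subst (z * w) (mapSeries - 1) =
      PowerSeries.subst (z * w) mapSeries - (1 : GF) := by
    have h := map_sub (PowerSeries.substAlgHom (R := ℚ) hs1) mapSeries 1
    rw [map_one] at h
    simpa [PowerSeries.coe_substAlgHom] using h
  have hA := one_sub_q_mul_lastClusterSeries
  have hUz := hU hs1
  have hUq := hU hs2
  have hF := z_mul_FC_eq
  rw [hB'] at hF
  have hF₀ := FC₀_eq
  set A := lastClusterSeries
  set B : GF := PowerSeries.subst (z * w) mapSeries
  set t := T (z * w)
  set t' := T (z * w * q)
  -- Both sides are `2 (U(zw) - U(zwq))`, as `2U = 1 - (1 - T)²`.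
  have hnum : (1 - t') ^ 2 - (1 - t) ^ 2 = 2 * ((1 - q) * A) := by
    rw [hA]
    linear_combination hUq - hUz
  constructor
  · rw [eq_div_iff ((map_ne_zero_iff ι hι).2 (mul_ne_zero (mul_ne_zero (mul_ne_zero h2 hz) hq)
      one_sub_T_ne_zero)), ← map_mul]
    congr 1
    rw [hnum]
    -- The factor `t` arises as `(1 - t)(B - 1) = t`.
    linear_combination 2 * (1 - q) * (1 - t) * hF + 2 * (1 - q) * A * hB
  · rw [eq_div_iff ((map_ne_zero_iff ι hι).2 (mul_ne_zero (mul_ne_zero h2 hq)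
      one_sub_T_ne_zero)), ← map_mul]
    congr 1
    rw [hnum]
    linear_combination 2 * (1 - q) * (1 - t) * hF₀ + 2 * (1 - q) * A * hB
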